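/- **Setting.** Let $G_n=(V_n,E_n)$, $n\ge 1$, be finite simple graphs, let $\mathcal S_n$ be a family of spanning subgraphs of $G_n$, each identified with its edge set $\pi\subseteq E_n$, and let $m=m_n\in\mathbb N$. Write $\mathbb P_\pi$ for the law of $\pi$ chosen uniformly at random from $\mathcal S_n$. A *partial matching* is a set of pairwise vertex-disjoint edges. Assume the following; conditions on $G_n$ and $\mathcal S_n$ are required for all sufficiently large $n$. (I) $G_n$ is edge-transitive, $|V_n|=c\,n$ for a constant $c\in\mathbb N$, and $|E_n|=\Theta(|V_n|^2)$. (II) For each $n$ the weights $(\omega_e)_{e\in E_n}$ are i.i.d. with values in $(-\infty,+\infty]$, with a common law that does not depend on $n$, $\mathbb P(\omega_e=+\infty)<1$, and $\psi(\beta):=\log\mathbb E\,e^{-\beta\omega_e}<\infty$ for every $\beta\in(0,\infty)$, where $e^{-\infty}:=0$. (III.1) Every $\pi\in\mathcal S_n$ has exactly $m$ edges, and $\lim_{n\to\infty} m^2/(2|E_n|)=\gamma\in(0,\infty)$. (III.2) Every partial matching $\Gamma\subseteq E_n$ is contained in some $\pi\in\mathcal S_n$. (III.3) There is a constant $\rho\in(0,\infty)$,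 independent of $n$, such that for every partial matching $\Gamma\subseteq E_n$ $$\left|\frac{\mathbb P_\pi(\Gamma\subseteq\pi)}{\prod_{e\in\Gamma}\mathbb P_\pi(e\in\pi)}-1\right|\le\frac{\rho^{|\Gamma|}}{\sqrt m}.$$ (III.4) There is a constant $\rho\in(0,\infty)$, independent of $n$, such that for every $\Gamma\subseteq E_n$ that is contained in some $\pi\in\mathcal S_n$ and is not a partial matching, $\mathbb P_\pi(\Gamma\subseteq\pi)\le\rho^{|\Gamma|}\prod_{e\in\Gamma}\mathbb P_\pi(e\in\pi)$. (IV) $\mathbb P_\pi(e\in\pi)$ is the same for all $e\in E_n$ (hence equal to $m/|E_n|$). For $\beta>0$ and $W(\pi)=\sum_{e\in\pi}\omega_e$, the Gibbs measure on $\mathcal S_n$ is $$\mathbb P_{\beta,\omega}(\pi)=\frac{1}{Z_n(\beta)}\cdot\frac{1}{|\mathcal S_n|}\,e^{-\beta W(\pi)},\qquad Z_n(\beta)=\frac{1}{|\mathcal S_n|}\sum_{\pi\in\mathcal S_n}e^{-\beta W(\pi)},$$ and $\langle\cdot\rangle_\beta$ denotes expectation, with the weights $\omega$ held fixed, over two independent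 samples $\pi,\pi'$ from $\mathbb P_{\beta,\omega}$ (with value $0$, say, when $Z_n(\beta)=0$). **Theorem.** Fix $\beta\in(0,\infty)$ and put $\lambda=2\gamma\,e^{\psi(2\beta)-2\psi(\beta)}$. Then, given the weights, the law of the number $|\pi\cap\pi'|$ of common edges converges weakly, in probability with respect to the weights, to the Poisson distribution with mean $\lambda$: for every bounded $f:\mathbb N\to\mathbb R$, $$\langle f(|\pi\cap\pi'|)\rangle_\beta\longrightarrow\sum_{k\ge0}f(k)\,e^{-\lambda}\frac{\lambda^k}{k!}\qquad\text{in probability as } n\to\infty.$$ Moreover, for every $\theta\in\mathbb R$, $$\left\langle e^{\theta|\pi\cap\pi'|}\right\rangle_\beta\longrightarrow\exp\!\left(\lambda\,(e^{\theta}-1)\right)\qquad\text{in probability as } n\to\infty.$$ -/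

import Mathlib

open Filter Topology MeasureTheory ProbabilityTheory Asymptotics
open scoped ENNReal NNReal

noncomputable section

namespace GibbsOverlap

/-! ### Graphs and families of edge sets

A spanning subgraph of `G` is identified with its set of edges, a `Finset G.edgeSet`. -/

/-- `G` is edge-transitive: its automorphism group acts transitively on its edges. -/
def EdgeTransitive {V : Type*} (G : SimpleGraph V) : Prop :=
  ∀ e ∈ G.edgeSet, ∀ f ∈ G.edgeSet, ∃ φ : G ≃g G, Sym2.map φ e = f

/-- A partial matching: a set of edges no two of which share a vertex. -/
def IsPartialMatching {V : Type*} {G : SimpleGraph V} (Γ : Finset G.edgeSet) : Prop :=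
  ∀ e ∈ Γ, ∀ f ∈ Γ, e ≠ f → ∀ v : V, v ∈ (e : Sym2 V) → v ∉ (f : Sym2 V)

open Classical in
/-- `ℙ_π(Γ ⊆ π)` for `π` chosen uniformly at random from the family `S`. -/
def unifProb {E : Type*} (S : Finset (Finset E)) (Γ : Finset E) : ℝ :=
  ((S.filter fun π => Γ ⊆ π).card : ℝ) / (S.card : ℝ)

/-- `ℙ_π(e ∈ π)` for `π` chosen uniformly at random from the family `S`. -/
def edgeProb {E : Type*} (S : Finset (Finset E)) (e : E) : ℝ := unifProb S {e}

/-- The assumption on the graphs: for all large `n`, the graph `G n` is edge-transitive and has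
`c * n` vertices; the number of edges is of the exact order of the square of the number of
vertices. -/
structure GraphAssumption {V : ℕ → Type*} [∀ n, Fintype (V n)] (G : ∀ n, SimpleGraph (V n))
    (c : ℕ) : Prop where
  edgeTransitive : ∀ᶠ n in atTop, EdgeTransitive (G n)
  card_vertices : ∀ᶠ n in atTop, Fintype.card (V n) = c * n
  card_edges : (fun n => (Nat.card (G n).edgeSet : ℝ)) =Θ[atTop]
    fun n => (Fintype.card (V n) : ℝ) ^ 2

/-- The assumption on the family `S n` of admissible edge sets (for all large `n`). -/
structure OptimizationAssumption {V : ℕ → Type*} [∀ n, Fintype (V n)]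
    (G : ∀ n, SimpleGraph (V n)) (S : ∀ n, Finset (Finset (G n).edgeSet)) (m : ℕ → ℕ) (γ : ℝ) :
    Prop where
  /-- All elements of `S n` have the same number `m n` of edges. -/
  card_eq : ∀ᶠ n in atTop, ∀ π ∈ S n, π.card = m n
  /-- `m² / (2|E|) → γ ∈ (0, ∞)`. -/
  gamma_pos : 0 < γ
  tendsto_gamma :
    Tendsto (fun n => (m n : ℝ) ^ 2 / (2 * (Nat.card (G n).edgeSet : ℝ))) atTop (𝓝 γ)
  /-- Every partial matching is contained in an element of `S n`. -/
  extend_matching : ∀ᶠ n in atTop, ∀ Γ : Finset (G n).edgeSet, IsPartialMatching Γ →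
    ∃ π ∈ S n, Γ ⊆ π
  /-- Edges of a partial matching are approximately independent. -/
  matching_bound : ∃ ρ : ℝ, 0 < ρ ∧ ∀ᶠ n in atTop, ∀ Γ : Finset (G n).edgeSet,
    IsPartialMatching Γ →
      |unifProb (S n) Γ / (∏ e ∈ Γ, edgeProb (S n) e) - 1| ≤ ρ ^ Γ.card / √(m n : ℝ)
  /-- A bound for subsets of elements of `S n` that are not partial matchings. -/
  nonmatching_bound : ∃ ρ : ℝ, 0 < ρ ∧ ∀ᶠ n in atTop, ∀ Γ : Finset (G n).edgeSet,
    (∃ π ∈ S n, Γ ⊆ π) → ¬ IsPartialMatching Γ →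
      unifProb (S n) Γ ≤ ρ ^ Γ.card * ∏ e ∈ Γ, edgeProb (S n) e

/-! ### Edge weights

Weights take values in `(-∞, +∞]`, so they are modelled in `EReal`; that `-∞` has probability
zero follows from the finiteness of the exponential moments. -/

/-- `E exp(-β ω)` for a weight `ω` with law `ν`; here `exp(-∞) = 0`. -/
def laplace (ν : Measure EReal) (β : ℝ) : ℝ≥0∞ := ∫⁻ x, EReal.exp (-((β : EReal) * x)) ∂ν

/-- `ψ(β) = log E exp(-β ω)`. -/
def psi (ν : Measure EReal) (β : ℝ) : ℝ := Real.log (laplace ν β).toReal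

/-- The assumption on the weights: for each `n`, the weights on the edges of `G n` are independent
with common law `ν` (the same for all `n`), `ψ(β) < ∞` for all `β > 0`, and the weights are not
almost surely infinite. -/
structure WeightAssumption {V : ℕ → Type*} (G : ∀ n, SimpleGraph (V n)) {Ω : Type*}
    [MeasurableSpace Ω] (P : Measure Ω) (ω : ∀ n, (G n).edgeSet → Ω → EReal)
    (ν : Measure EReal) : Prop where
  measurable : ∀ n e, Measurable (ω n e)
  indep : ∀ n, iIndepFun (ω n) P
  law : ∀ n e, P.map (ω n e) = ν
  laplace_lt_top : ∀ β : ℝ, 0 < β → laplace ν β < ∞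
  not_ae_top : ν {⊤} < 1

/-! ### The Gibbs measure -/

/-- The total weight `W(π) = ∑_{e ∈ π} w e`. -/
def totalWeight {E : Type*} (w : E → EReal) (π : Finset E) : EReal := ∑ e ∈ π, w e

/-- `exp(-β W(π))`. -/
def boltzmann {E : Type*} (β : ℝ) (w : E → EReal) (π : Finset E) : ℝ :=
  (EReal.exp (-((β : EReal) * totalWeight w π))).toReal

/-- The partition function `Z(β) = |S|⁻¹ ∑_{π ∈ S} exp(-β W(π))`. -/
def partitionFn {E : Type*} (S : Finset (Finset E)) (β : ℝ) (w : E → EReal) : ℝ :=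
  1 / (S.card : ℝ) * ∑ π ∈ S, boltzmann β w π

/-- The Gibbs probability `Z(β)⁻¹ |S|⁻¹ exp(-β W(π))` of `π ∈ S`. -/
def gibbsProb {E : Type*} (S : Finset (Finset E)) (β : ℝ) (w : E → EReal) (π : Finset E) : ℝ :=
  1 / partitionFn S β w * (1 / (S.card : ℝ)) * boltzmann β w π

open Classical in
/-- The expectation of `f(|π ∩ π'|)` for two independent samples `π, π'` from the Gibbs measure
with the weights `w` held fixed. -/
def overlapAverage {E : Type*} (S : Finset (Finset E)) (β : ℝ) (w : E → EReal) (f : ℕ → ℝ) : ℝ :=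
  ∑ π ∈ S, ∑ π' ∈ S, gibbsProb S β w π * gibbsProb S β w π' * f (π ∩ π').card

end GibbsOverlap

end

/-! Divide each factor `exp (-β ω_e)` by its mean, giving independent `x_e` with mean 1 and second
moment `a = exp (ψ(2β) - 2ψ(β))`. The normalization cancels in the Gibbs measure because all
configurations have `m` edges. Let `ζ(Λ)` be the normalized partition function restricted to `Λ ⊆
π`. Newton's formula `f(k) = ∑ⱼ (k choose j) (Δʲf)(0)`, applied on the subsets of `π ∩ π'`, gives
`⟨f(|π ∩ π'|)⟩ = ∑_Λ (Δ^|Λ| f)(0) ζ(Λ)² / ζ(∅)²` (`overlapAverage_eq`).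

Expanded in the centered variables `x_e - 1`, `ζ(Λ)` has the inclusion probabilities `ℙ(Δ ⊆ π)`, `Δ
⊇ Λ`, as coefficients. The expansion is orthogonal, so `∑_Λ K^|Λ| E ζ(Λ)²` equals a weighted ℓ² norm
of the coefficients (`sum_integral_chaos_sq`). In that norm the coefficients are asymptotically
`p^|Δ|` with `p = m/|E|` (`sum_unifProb_sub_pow_sq_le`): partial matchings cost `O(1/m)`, the other
sets `O(|V|³ p⁴)`, and both vanish because `|E| p² → 2γ` and `|E|` is of order `|V|²`.

One may therefore replace the family by independent edges of density `p`. There everything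
factorizes: the ratio becomes `∑_Λ (Δ^|Λ| f)(0) ∏_{e ∈ Λ} q_e`, where `q_e ≈ p² x_e²` is the
probability that both samples contain `e`. The law of large numbers gives `∑ q_e → 2γ a = λ` and `∑
q_e² → 0`, so the factorial-moment series tends to that of the Poisson law
(`tendsto_sum_prod_pairProb`). The ratio passes to the limit since the product-model partition
function stays away from 0 in probability (`tendstoInMeasure_div`). -/

namespace GibbsOverlap

/-! ### Chaos expansion of the overlap average -/

section Algebra

open Classical in
/-- The product of the factors `w e` over `Λ` and of the centered factors `w e - 1` over `Δ \ Λ`. -/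
noncomputable def tilt {E : Type*} [Fintype E] (w : E → ℝ) (Λ Δ : Finset E) : ℝ :=
  ∏ e, if e ∈ Λ then w e else if e ∈ Δ then w e - 1 else 1

open Classical in
/-- The polynomial with coefficients `u Δ` in the products `tilt w Λ Δ`, for `Δ ⊇ Λ`. -/
noncomputable def chaos {E : Type*} [Fintype E] (u : Finset E → ℝ) (w : E → ℝ) (Λ : Finset E) : ℝ :=
  ∑ Δ : Finset E, if Λ ⊆ Δ then u Δ * tilt w Λ Δ else 0

variable {E : Type*} [Fintype E]

lemma chaos_sub (u v : Finset E → ℝ) (w : E → ℝ) (Λ : Finset E) :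
    chaos (fun Δ => u Δ - v Δ) w Λ = chaos u w Λ - chaos v w Λ := by
  classical
  simp only [chaos, ← Finset.sum_sub_distrib]
  refine Finset.sum_congr rfl fun Δ _ => ?_
  split_ifs <;> ring

-- Expand `∏ (A_e + B_e)` over subsets `Δ`, where `A_e` carries the factor `c e` and `B_e` is 0 on
-- `Λ` and 1 elsewhere; the zeros kill every `Δ` not containing `Λ`.
open Classical in
lemma chaos_prod (c w : E → ℝ) (Λ : Finset E) :
    chaos (fun Δ => ∏ e ∈ Δ, c e) w Λ =
      ∏ e, if e ∈ Λ then c e * w e else 1 + c e * (w e - 1) := by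
  have h : ∀ e, (if e ∈ Λ then c e * w e else 1 + c e * (w e - 1)) =
      c e * (if e ∈ Λ then w e else w e - 1) + (if e ∈ Λ then 0 else 1) := by
    intro e; split_ifs <;> ring
  simp only [h]
  rw [Fintype.prod_add, chaos]
  refine Finset.sum_congr rfl fun Δ _ => ?_
  split_ifs with hΔ
  · rw [Finset.prod_mul_distrib, mul_assoc]
    congr 1
    have h2 : ∏ a ∈ Δᶜ, (if a ∈ Λ then (0 : ℝ) else 1) = 1 := by
      refine Finset.prod_eq_one fun a ha => ?_
      rw [if_neg]
      intro h; exact (Finset.mem_compl.1 ha) (hΔ h)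
    rw [h2, mul_one, tilt, ← Finset.prod_mul_prod_compl Δ]
    have h3 : ∏ a ∈ Δᶜ, (if a ∈ Λ then w a else if a ∈ Δ then w a - 1 else 1) = 1 := by
      refine Finset.prod_eq_one fun a ha => ?_
      rw [if_neg, if_neg (Finset.mem_compl.1 ha)]
      intro h; exact (Finset.mem_compl.1 ha) (hΔ h)
    rw [h3, mul_one]
    refine Finset.prod_congr rfl fun a ha => ?_
    simp [ha]
  · obtain ⟨a, ha, ha'⟩ := Finset.not_subset.1 hΔ
    rw [Finset.prod_eq_zero (Finset.mem_compl.2 ha') (by simp [ha]), mul_zero]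

lemma chaos_sum_smul {ι : Type*} (s : Finset ι) (b : ℝ) (u : ι → Finset E → ℝ) (w : E → ℝ)
    (Λ : Finset E) :
    chaos (fun Δ => b * ∑ i ∈ s, u i Δ) w Λ = b * ∑ i ∈ s, chaos (u i) w Λ := by
  classical
  simp only [chaos]
  rw [Finset.sum_comm, Finset.mul_sum]
  refine Finset.sum_congr rfl fun Δ _ => ?_
  split_ifs
  · rw [mul_assoc, Finset.sum_mul]
  · simp

open Classical in
/-- The chaos expansion of the partition function restricted to `Λ ⊆ π`. -/
lemma chaos_unifProb (S : Finset (Finset E)) (w : E → ℝ) (Λ : Finset E) :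
    chaos (unifProb S) w Λ =
      1 / (S.card : ℝ) * ∑ π ∈ S, if Λ ⊆ π then ∏ e ∈ π, w e else 0 := by
  -- The coefficients are an average over `π` of products of indicators, so `chaos_prod` applies for
  -- each `π`; an edge outside `Λ` then contributes `w e` if it lies in `π` and 1 otherwise.
  have h : unifProb S = fun Δ => 1 / (S.card : ℝ) *
      ∑ π ∈ S, ∏ e ∈ Δ, (if e ∈ π then (1 : ℝ) else 0) := by
    funext Δ
    rw [unifProb, Finset.card_filter, div_eq_mul_one_div, mul_comm]
    push_cast
    congr 1
    refine Finset.sum_congr (by congr) fun π _ => ?_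
    rw [Finset.prod_ite_zero]
    simp only [Finset.prod_const_one, Finset.subset_iff]
  rw [h, chaos_sum_smul]
  congr 1
  refine Finset.sum_congr rfl fun π _ => ?_
  rw [chaos_prod]
  split_ifs with hΛ
  · rw [← Finset.prod_mul_prod_compl π]
    have h1 : ∏ e ∈ πᶜ, (if e ∈ Λ then (if e ∈ π then (1 : ℝ) else 0) * w e
        else 1 + (if e ∈ π then (1 : ℝ) else 0) * (w e - 1)) = 1 := by
      refine Finset.prod_eq_one fun a ha => ?_
      have ha' := Finset.mem_compl.1 ha
      rw [if_neg fun h => ha' (hΛ h), if_neg ha']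
      ring
    rw [h1, mul_one]
    refine Finset.prod_congr rfl fun a ha => ?_
    simp [ha]
  · obtain ⟨a, ha, ha'⟩ := Finset.not_subset.1 hΛ
    exact Finset.prod_eq_zero (Finset.mem_univ a) (by simp [ha, ha'])

/-- The expansion of a function of the overlap along the subsets of `π ∩ π'`. -/
lemma sum_subset_fwdDiff {E : Type*} (f : ℕ → ℝ) (A : Finset E) :
    ∑ Λ ∈ A.powerset, (fwdDiff 1)^[Λ.card] f 0 = f A.card := by
  have h := shift_eq_sum_fwdDiff_iter 1 f A.card 0
  rw [Finset.sum_powerset_apply_card (fun k => (fwdDiff 1)^[k] f 0)]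
  simpa using h.symm

-- Squaring the restricted partition function gives pairs with `Λ ⊆ π ∩ π'`; summing the differences
-- over such `Λ` is Newton's formula and returns `f` of the overlap.
open Classical in
lemma sum_fwdDiff_mul_chaos_sq (S : Finset (Finset E)) (w : E → ℝ) (f : ℕ → ℝ) :
    ∑ Λ : Finset E, (fwdDiff 1)^[Λ.card] f 0 * chaos (unifProb S) w Λ ^ 2 =
      (1 / (S.card : ℝ)) ^ 2 * ∑ π ∈ S, ∑ π' ∈ S,
        (∏ e ∈ π, w e) * (∏ e ∈ π', w e) * f (π ∩ π').card := by
  have h : ∀ Λ : Finset E, (fwdDiff 1)^[Λ.card] f 0 * chaos (unifProb S) w Λ ^ 2 =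
      (1 / (S.card : ℝ)) ^ 2 * ∑ π ∈ S, ∑ π' ∈ S,
        (∏ e ∈ π, w e) * (∏ e ∈ π', w e) *
          (if Λ ⊆ π ∩ π' then (fwdDiff 1)^[Λ.card] f 0 else 0) := by
    intro Λ
    rw [chaos_unifProb, mul_pow, sq (∑ π ∈ S, _), Finset.sum_mul_sum, mul_left_comm,
      Finset.mul_sum]
    congr 1
    refine Finset.sum_congr rfl fun π _ => ?_
    rw [Finset.mul_sum]
    refine Finset.sum_congr rfl fun π' _ => ?_
    by_cases h1 : Λ ⊆ π <;> by_cases h2 : Λ ⊆ π' <;> simp [Finset.subset_inter_iff, h1, h2]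
    ring
  simp only [h]
  rw [← Finset.mul_sum, Finset.sum_comm]
  congr 1
  refine Finset.sum_congr rfl fun π _ => ?_
  rw [Finset.sum_comm]
  refine Finset.sum_congr rfl fun π' _ => ?_
  rw [← Finset.mul_sum, ← sum_subset_fwdDiff f (π ∩ π'), ← Finset.sum_filter]
  congr 1
  refine Finset.sum_congr ?_ fun _ _ => rfl
  ext Λ
  rw [Finset.mem_filter, Finset.mem_powerset]
  exact and_iff_right (Finset.mem_univ Λ)

end Algebra

/-! ### Poisson approximation of elementary symmetric sums -/

section Poisson

/-- The left side consists of two terms of the binomial expansion of the right side. -/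
lemma pow_div_factorial_add_le (s q : ℝ) (hs : 0 ≤ s) (hq : 0 ≤ q) (k : ℕ) :
    s ^ (k + 1) / (k + 1).factorial + q * (s ^ k / k.factorial) ≤
      (s + q) ^ (k + 1) / (k + 1).factorial := by
  have h : s ^ (k + 1) + (k + 1) * q * s ^ k ≤ (s + q) ^ (k + 1) := by
    induction k with
    | zero => simp
    | succ k ih =>
      have := mul_le_mul_of_nonneg_right ih (add_nonneg hs hq)
      rw [← pow_succ] at this
      refine le_trans ?_ this
      have : 0 ≤ (k + 1) * q * s ^ k * q := by positivity
      push_cast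
      ring_nf at this ⊢
      nlinarith
  rw [Nat.factorial_succ]
  have h1 : (0 : ℝ) < k.factorial := by positivity
  push_cast
  rw [le_div_iff₀ (by positivity)]
  refine le_trans (le_of_eq ?_) h
  field_simp

/-- Expanding the `k`-th power produces each `k`-subset `k!` times, plus nonnegative terms with
repetitions. -/
lemma sum_powersetCard_prod_le {E : Type*} (q : E → ℝ) (hq : ∀ e, 0 ≤ q e) (A : Finset E) (k : ℕ) :
    ∑ Λ ∈ A.powersetCard k, ∏ e ∈ Λ, q e ≤ (∑ e ∈ A, q e) ^ k / k.factorial := by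
  classical
  induction A using Finset.induction_on generalizing k with
  | empty =>
    cases k with
    | zero => simp
    | succ k => rw [Finset.powersetCard_eq_empty.2 (by simp)]; simp
  | insert a A ha ih =>
    cases k with
    | zero => simp
    | succ k =>
      rw [Finset.powersetCard_succ_insert ha, Finset.sum_union, Finset.sum_image,
        Finset.sum_insert ha, add_comm (q a)]
      · refine le_trans (add_le_add (ih (k + 1)) ?_) (pow_div_factorial_add_le _ _
          (Finset.sum_nonneg fun e _ => hq e) (hq a) k)
        refine le_trans (le_of_eq ?_) (mul_le_mul_of_nonneg_left (ih k) (hq a))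
        rw [Finset.mul_sum]
        refine Finset.sum_congr rfl fun Λ hΛ => ?_
        rw [Finset.prod_insert]
        exact fun h => ha ((Finset.mem_powersetCard.1 hΛ).1 h)
      · intro s hs t ht hst
        have h1 : a ∉ s := fun h => ha ((Finset.mem_powersetCard.1 hs).1 h)
        have h2 : a ∉ t := fun h => ha ((Finset.mem_powersetCard.1 ht).1 h)
        rw [← Finset.erase_insert h1, hst, Finset.erase_insert h2]
      · rw [Finset.disjoint_left]
        intro s hs hs'
        obtain ⟨t, _, rfl⟩ := Finset.mem_image.1 hs'
        exact ha ((Finset.mem_powersetCard.1 hs).1 (Finset.mem_insert_self a t))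

lemma hasSum_powersetCard {E : Type*} [Fintype E] (F : ℕ → Finset E → ℝ) :
    HasSum (fun k => ∑ Λ ∈ (Finset.univ : Finset E).powersetCard k, F k Λ)
      (∑ Λ : Finset E, F Λ.card Λ) := by
  have h : ∑ Λ : Finset E, F Λ.card Λ = ∑ k ∈ Finset.range ((Finset.univ : Finset E).card + 1),
      ∑ Λ ∈ (Finset.univ : Finset E).powersetCard k, F k Λ := by
    rw [← Finset.powerset_univ, Finset.sum_powerset]
    refine Finset.sum_congr rfl fun k _ => Finset.sum_congr rfl fun Λ hΛ => ?_
    rw [(Finset.mem_powersetCard.1 hΛ).2]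
  rw [h]
  refine hasSum_sum_of_ne_finset_zero fun k hk => ?_
  rw [Finset.powersetCard_eq_empty.2 (by simpa using hk), Finset.sum_empty]

lemma hasSum_exp_pow (x : ℝ) : HasSum (fun k : ℕ => x ^ k / k.factorial) (Real.exp x) := by
  rw [Real.exp_eq_exp_ℝ]
  exact NormedSpace.expSeries_div_hasSum_exp x

/-- With `v = u - 2u²`, `exp (-v) ≥ 1 - v` and `(1 + u)(1 - v) = 1 + u²(1 + 2u) ≥ 1`. -/
lemma exp_sub_two_mul_sq_le (u : ℝ) (hu : -(1 / 2) ≤ u) : Real.exp (u - 2 * u ^ 2) ≤ 1 + u := by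
  have h := Real.add_one_le_exp (-(u - 2 * u ^ 2))
  have h2 : 1 ≤ (1 + u) * (-(u - 2 * u ^ 2) + 1) := by nlinarith [mul_nonneg (sq_nonneg u) (by linarith : 0 ≤ 1 + 2 * u)]
  have h3 : 1 ≤ (1 + u) * Real.exp (-(u - 2 * u ^ 2)) :=
    h2.trans (mul_le_mul_of_nonneg_left h (by linarith))
  have h4 : Real.exp (u - 2 * u ^ 2) * Real.exp (-(u - 2 * u ^ 2)) = 1 := by
    rw [← Real.exp_add]; simp
  have h5 := Real.exp_pos (-(u - 2 * u ^ 2))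
  nlinarith

lemma summable_mul_pow_div_factorial (g : ℕ → ℝ) (C K : ℝ)
    (hg : ∀ k, |g k| ≤ C * K ^ k) (x : ℝ) : Summable fun k => g k * (x ^ k / k.factorial) := by
  refine Summable.of_norm_bounded (g := fun k => C * ((K * |x|) ^ k / k.factorial))
    ((hasSum_exp_pow _).summable.mul_left C) fun k => ?_
  rw [Real.norm_eq_abs, abs_mul, abs_div, abs_pow, mul_pow, Nat.abs_cast]
  have := mul_le_mul_of_nonneg_right (hg k) (by positivity : 0 ≤ |x| ^ k / k.factorial)
  refine this.trans (le_of_eq (by ring))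

/-- Poisson approximation: the factorial-moment series of a family of small probabilities `q e`
is close to the one of the Poisson distribution with mean `l`. -/
lemma abs_sum_prod_sub_tsum_le {E : Type*} [Fintype E] (g : ℕ → ℝ) (C K : ℝ) (hK : 0 ≤ K)
    (hg : ∀ k, |g k| ≤ C * K ^ k) (q : E → ℝ) (hq : ∀ e, 0 ≤ q e) (l : ℝ) (hl : 0 ≤ l) :
    |∑ Λ : Finset E, g Λ.card * ∏ e ∈ Λ, q e - ∑' k, g k * (l ^ k / k.factorial)| ≤
      C * (Real.exp (K * ∑ e, q e) * (2 * K ^ 2 * ∑ e, q e ^ 2) +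
        |Real.exp (K * ∑ e, q e) - Real.exp (K * l)|) := by
  set s := ∑ e, q e with hs
  have hs0 : 0 ≤ s := Finset.sum_nonneg fun e _ => hq e
  have hC : 0 ≤ C := by have := (abs_nonneg _).trans (hg 0); simpa using this
  have h1 : HasSum (fun k => g k * ∑ Λ ∈ (Finset.univ : Finset E).powersetCard k, ∏ e ∈ Λ, q e)
      (∑ Λ : Finset E, g Λ.card * ∏ e ∈ Λ, q e) := by
    simpa only [Finset.mul_sum] using hasSum_powersetCard (fun k Λ => g k * ∏ e ∈ Λ, q e)
  have h2 := (summable_mul_pow_div_factorial g C K hg s).hasSum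
  have h3 := (summable_mul_pow_div_factorial g C K hg l).hasSum
  have h4 : HasSum (fun k => K ^ k * ∑ Λ ∈ (Finset.univ : Finset E).powersetCard k, ∏ e ∈ Λ, q e)
      (∏ e, (1 + K * q e)) := by
    have := hasSum_powersetCard (fun k (Λ : Finset E) => K ^ k * ∏ e ∈ Λ, q e)
    simp only [← Finset.mul_sum] at this
    convert! this using 1
    classical
    rw [Finset.prod_one_add, Finset.powerset_univ]
    simp [Finset.prod_mul_distrib]
  have h5 := hasSum_exp_pow (K * s)
  have h6 := hasSum_exp_pow (K * l)
  -- Each symmetric sum is at most `s ^ k / k!`, so the signs agree termwise and the bound on `g`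
  -- reduces the error to the case `g k = K ^ k`, where both series are explicit.
  have hA : |∑ Λ : Finset E, g Λ.card * ∏ e ∈ Λ, q e - ∑' k, g k * (s ^ k / k.factorial)| ≤
      C * (Real.exp (K * s) - ∏ e, (1 + K * q e)) := by
    refine (h1.sub h2).norm_le_of_bounded ((h5.sub h4).mul_left C) fun k => ?_
    rw [← mul_sub, Real.norm_eq_abs, abs_mul, mul_pow, mul_div_assoc, ← mul_sub, ← mul_assoc]
    have := sum_powersetCard_prod_le q hq Finset.univ k
    rw [abs_sub_comm, abs_of_nonneg (sub_nonneg.2 this)]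
    exact mul_le_mul_of_nonneg_right (hg k) (sub_nonneg.2 this)
  have hB : |∑' k, g k * (s ^ k / k.factorial) - ∑' k, g k * (l ^ k / k.factorial)| ≤
      C * |Real.exp (K * s) - Real.exp (K * l)| := by
    have key : ∀ a b : ℝ, 0 ≤ b → b ≤ a →
        |∑' k, g k * (a ^ k / k.factorial) - ∑' k, g k * (b ^ k / k.factorial)| ≤
        C * |Real.exp (K * a) - Real.exp (K * b)| := by
      intro a b hb hab
      have e : Real.exp (K * b) ≤ Real.exp (K * a) :=
        Real.exp_le_exp.2 (mul_le_mul_of_nonneg_left hab hK)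
      rw [abs_of_nonneg (sub_nonneg.2 e)]
      have h2 := (summable_mul_pow_div_factorial g C K hg a).hasSum
      have h3 := (summable_mul_pow_div_factorial g C K hg b).hasSum
      refine (h2.sub h3).norm_le_of_bounded
        (((hasSum_exp_pow (K * a)).sub (hasSum_exp_pow (K * b))).mul_left C) fun k => ?_
      have : b ^ k / k.factorial ≤ a ^ k / k.factorial := by gcongr
      rw [← mul_sub, Real.norm_eq_abs, abs_mul, mul_pow, mul_div_assoc, mul_pow, mul_div_assoc,
        ← mul_sub, ← mul_assoc, abs_of_nonneg (sub_nonneg.2 this)]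
      exact mul_le_mul_of_nonneg_right (hg k) (sub_nonneg.2 this)
    rcases le_total l s with h | h
    · exact key s l hl h
    · rw [abs_sub_comm, abs_sub_comm (Real.exp _)]
      exact key l s hs0 h
  -- `∏ (1 + K q) ≥ exp (K s - v)` with `v = 2 K² ∑ q²`, and `exp (-v) ≥ 1 - v`.
  have hC2 : Real.exp (K * s) - ∏ e, (1 + K * q e) ≤
      Real.exp (K * s) * (2 * K ^ 2 * ∑ e, q e ^ 2) := by
    have e1 : Real.exp (K * s - 2 * K ^ 2 * ∑ e, q e ^ 2) ≤ ∏ e, (1 + K * q e) := by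
      rw [hs, Finset.mul_sum, Finset.mul_sum, ← Finset.sum_sub_distrib, Real.exp_sum]
      refine Finset.prod_le_prod (fun e _ => (Real.exp_pos _).le) fun e _ => ?_
      have := exp_sub_two_mul_sq_le (K * q e) (by have := mul_nonneg hK (hq e); linarith)
      rwa [mul_pow, ← mul_assoc] at this
    have e2 := Real.add_one_le_exp (-(2 * K ^ 2 * ∑ e, q e ^ 2))
    rw [sub_eq_add_neg, Real.exp_add] at e1
    have e3 := Real.exp_pos (K * s)
    nlinarith
  calc _ ≤ _ := abs_sub_le _ (∑' k, g k * (s ^ k / k.factorial)) _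
    _ ≤ _ := add_le_add hA hB
    _ ≤ _ := by rw [← mul_add]; gcongr

end Poisson

/-! ### Orthogonality of the chaos expansion -/

section SecondMoment

variable {E Ω : Type*} [Fintype E] [MeasurableSpace Ω] {P : Measure Ω} [IsProbabilityMeasure P]

lemma integrable_prod_comp {x : E → Ω → ℝ} (hx : ∀ e, Measurable (x e)) (hind : iIndepFun x P)
    {φ : E → ℝ → ℝ} (hφ : ∀ e, Measurable (φ e)) (hint : ∀ e, Integrable (fun y => φ e (x e y)) P) :
    Integrable (fun y => ∏ e, φ e (x e y)) P := by
  have h : Integrable (fun z : E → ℝ => ∏ e, φ e (z e)) (Measure.pi fun e => P.map (x e)) := by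
    have (e : E) : IsProbabilityMeasure (P.map (x e)) :=
      Measure.isProbabilityMeasure_map (hx e).aemeasurable
    refine Integrable.fintype_prod_dep fun e => ?_
    exact (integrable_map_measure (hφ e).aestronglyMeasurable (hx e).aemeasurable).2 (hint e)
  rw [← hind.map_fun_eq_pi_map fun e => (hx e).aemeasurable] at h
  exact (integrable_map_measure h.aestronglyMeasurable
    (measurable_pi_lambda _ hx).aemeasurable).1 h

open Classical in
lemma tilt_mul_tilt (w : E → ℝ) (Λ Δ Δ' : Finset E) :
    tilt w Λ Δ * tilt w Λ Δ' = ∏ e, (fun t : ℝ => (if e ∈ Λ then t else if e ∈ Δ then t - 1 else 1) *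
      (if e ∈ Λ then t else if e ∈ Δ' then t - 1 else 1)) (w e) := by
  rw [tilt, tilt, ← Finset.prod_mul_distrib]

variable {x : E → Ω → ℝ} {a : ℝ}

omit [Fintype E] in
lemma integrable_of_sq (hx : ∀ e, Measurable (x e)) (h2 : ∀ e, Integrable (fun y => x e y ^ 2) P)
    (e : E) : Integrable (x e) P :=
  ((memLp_two_iff_integrable_sq (hx e).aestronglyMeasurable).2 (h2 e)).integrable (by norm_num)

omit [Fintype E] in
open Classical in
lemma integrable_factor (hx : ∀ e, Measurable (x e)) (h2 : ∀ e, Integrable (fun y => x e y ^ 2) P)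
    (Λ Δ Δ' : Finset E) (e : E) :
    Integrable (fun y => (if e ∈ Λ then x e y else if e ∈ Δ then x e y - 1 else 1) *
      (if e ∈ Λ then x e y else if e ∈ Δ' then x e y - 1 else 1)) P := by
  have h1 := integrable_of_sq hx h2 e
  have h2' := h2 e
  have h1sub : Integrable (fun y => x e y - 1) P := h1.sub (integrable_const 1)
  split_ifs
  · simpa only [← sq] using h2'
  · have : Integrable (fun y => x e y ^ 2 - 2 * x e y + 1) P :=
      (h2'.sub (h1.const_mul 2)).add (integrable_const _)
    refine this.congr (ae_of_all _ fun y => ?_)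
    ring
  · simpa using h1sub
  · simpa using h1sub
  · simp

lemma integrable_tilt_mul_tilt (hx : ∀ e, Measurable (x e)) (hind : iIndepFun x P)
    (h2 : ∀ e, Integrable (fun y => x e y ^ 2) P) (Λ Δ Δ' : Finset E) :
    Integrable (fun y => tilt (fun e => x e y) Λ Δ * tilt (fun e => x e y) Λ Δ') P := by
  classical
  simp only [tilt_mul_tilt]
  refine integrable_prod_comp hx hind
    (φ := fun e t => (if e ∈ Λ then t else if e ∈ Δ then t - 1 else 1) *
      (if e ∈ Λ then t else if e ∈ Δ' then t - 1 else 1)) (fun e => ?_)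
    fun e => integrable_factor hx h2 Λ Δ Δ' e
  split_ifs <;> fun_prop

omit [Fintype E] in
lemma integral_sub_one_sq (hx : ∀ e, Measurable (x e)) (h2 : ∀ e, Integrable (fun y => x e y ^ 2) P)
    (m1 : ∀ e, ∫ y, x e y ∂P = 1) (m2 : ∀ e, ∫ y, x e y ^ 2 ∂P = a) (e : E) :
    ∫ y, (x e y - 1) * (x e y - 1) ∂P = a - 1 := by
  have h1 := integrable_of_sq hx h2 e
  have : ∀ y, (x e y - 1) * (x e y - 1) = x e y ^ 2 - 2 * x e y + 1 := fun y => by ring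
  have h3 : Integrable (fun y => x e y ^ 2 - 2 * x e y) P := (h2 e).sub (h1.const_mul 2)
  simp only [this]
  rw [integral_add h3 (integrable_const _),
    integral_sub (h2 e) (h1.const_mul 2), integral_const_mul, m1, m2]
  simp; ring

-- By independence the expectation factorizes. An edge in exactly one of `Δ`, `Δ'` lies outside `Λ`
-- and contributes the mean 0 of `x e - 1`; if `Δ = Δ'`, edges of `Λ` contribute `a` and those of `Δ
-- \ Λ` the variance `a - 1`.
open Classical in
lemma integral_tilt_mul_tilt (hx : ∀ e, Measurable (x e)) (hind : iIndepFun x P)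
    (h2 : ∀ e, Integrable (fun y => x e y ^ 2) P)
    (m1 : ∀ e, ∫ y, x e y ∂P = 1) (m2 : ∀ e, ∫ y, x e y ^ 2 ∂P = a)
    {Λ Δ Δ' : Finset E} (hΔ : Λ ⊆ Δ) (hΔ' : Λ ⊆ Δ') :
    ∫ y, tilt (fun e => x e y) Λ Δ * tilt (fun e => x e y) Λ Δ' ∂P =
      if Δ = Δ' then a ^ Λ.card * (a - 1) ^ (Δ.card - Λ.card) else 0 := by
  simp only [tilt_mul_tilt]
  rw [hind.integral_fun_prod_comp (fun e => (hx e).aemeasurable)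
    (f := fun e t => (if e ∈ Λ then t else if e ∈ Δ then t - 1 else 1) *
      (if e ∈ Λ then t else if e ∈ Δ' then t - 1 else 1))
    (fun e => by
      apply Measurable.aestronglyMeasurable
      split_ifs <;> fun_prop)]
  have h0 : ∀ e, ∫ y, (x e y - 1) ∂P = 0 := fun e => by
    rw [integral_sub (integrable_of_sq hx h2 e) (integrable_const _), m1]; simp
  split_ifs with h
  · subst h
    have : ∀ e, ∫ y, (if e ∈ Λ then x e y else if e ∈ Δ then x e y - 1 else 1) *
        (if e ∈ Λ then x e y else if e ∈ Δ then x e y - 1 else 1) ∂P =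
        (if e ∈ Λ then a else 1) * (if e ∈ Δ \ Λ then a - 1 else 1) := by
      intro e
      by_cases h1 : e ∈ Λ
      · simp only [h1, if_true, Finset.mem_sdiff, not_true, and_false, if_false, mul_one, ← sq]
        exact m2 e
      · by_cases h3 : e ∈ Δ
        · simp only [h1, h3, if_true, Finset.mem_sdiff, not_false_iff, and_self, if_false, one_mul]
          exact integral_sub_one_sq hx h2 m1 m2 e
        · simp [h1, h3]
    simp only [this]
    rw [Finset.prod_mul_distrib, Finset.prod_ite_mem, Finset.prod_ite_mem, Finset.univ_inter,
      Finset.univ_inter, Finset.prod_const, Finset.prod_const, Finset.card_sdiff_of_subset hΔ]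
  · obtain ⟨e, he⟩ : ∃ e, ¬ (e ∈ Δ ↔ e ∈ Δ') := by
      by_contra! hcon
      exact h (Finset.ext hcon)
    refine Finset.prod_eq_zero (Finset.mem_univ e) ?_
    have hΛ : e ∉ Λ := fun h' => he ⟨fun _ => hΔ' h', fun _ => hΔ h'⟩
    by_cases h3 : e ∈ Δ
    · have h4 : e ∉ Δ' := fun h4 => he ⟨fun _ => h4, fun _ => h3⟩
      simpa [hΛ, h3, h4] using h0 e
    · have h4 : e ∈ Δ' := by by_contra h4; exact he ⟨fun h => absurd h h3, fun h => absurd h h4⟩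
      simpa [hΛ, h3, h4] using h0 e

open Classical in
lemma chaos_sq (u : Finset E → ℝ) (w : E → ℝ) (Λ : Finset E) :
    chaos u w Λ ^ 2 = ∑ Δ : Finset E, ∑ Δ' : Finset E,
      if Λ ⊆ Δ ∧ Λ ⊆ Δ' then u Δ * u Δ' * (tilt w Λ Δ * tilt w Λ Δ') else 0 := by
  rw [chaos, sq, Finset.sum_mul_sum]
  refine Finset.sum_congr rfl fun Δ _ => Finset.sum_congr rfl fun Δ' _ => ?_
  by_cases h1 : Λ ⊆ Δ <;> by_cases h2 : Λ ⊆ Δ' <;> simp [h1, h2]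
  ring

lemma integrable_chaos_sq (hx : ∀ e, Measurable (x e)) (hind : iIndepFun x P)
    (h2 : ∀ e, Integrable (fun y => x e y ^ 2) P) (u : Finset E → ℝ) (Λ : Finset E) :
    Integrable (fun y => chaos u (fun e => x e y) Λ ^ 2) P := by
  classical
  simp only [chaos_sq]
  refine integrable_finsetSum _ fun Δ _ => integrable_finsetSum _ fun Δ' _ => ?_
  split_ifs
  · exact (integrable_tilt_mul_tilt hx hind h2 Λ Δ Δ').const_mul _
  · exact integrable_zero _ _ _

open Classical in
lemma integral_chaos_sq (hx : ∀ e, Measurable (x e)) (hind : iIndepFun x P)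
    (h2 : ∀ e, Integrable (fun y => x e y ^ 2) P)
    (m1 : ∀ e, ∫ y, x e y ∂P = 1) (m2 : ∀ e, ∫ y, x e y ^ 2 ∂P = a)
    (u : Finset E → ℝ) (Λ : Finset E) :
    ∫ y, chaos u (fun e => x e y) Λ ^ 2 ∂P =
      ∑ Δ : Finset E, if Λ ⊆ Δ then u Δ ^ 2 * (a ^ Λ.card * (a - 1) ^ (Δ.card - Λ.card)) else 0 := by
  have hi : ∀ Δ Δ' : Finset E, Integrable (fun y => if Λ ⊆ Δ ∧ Λ ⊆ Δ' then u Δ * u Δ' *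
      (tilt (fun e => x e y) Λ Δ * tilt (fun e => x e y) Λ Δ') else 0) P := by
    intro Δ Δ'
    split_ifs
    · exact (integrable_tilt_mul_tilt hx hind h2 Λ Δ Δ').const_mul _
    · exact integrable_zero _ _ _
  simp only [chaos_sq]
  rw [integral_finsetSum _ fun Δ _ => integrable_finsetSum _ fun Δ' _ => hi Δ Δ']
  refine Finset.sum_congr rfl fun Δ _ => ?_
  rw [integral_finsetSum _ fun Δ' _ => hi Δ Δ']
  by_cases h : Λ ⊆ Δ
  · rw [Finset.sum_eq_single Δ]
    · simp only [h, and_self, if_true]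
      rw [integral_const_mul, integral_tilt_mul_tilt hx hind h2 m1 m2 h h, if_pos rfl, sq]
    · intro Δ' _ hne
      by_cases h' : Λ ⊆ Δ'
      · simp only [h, h', and_self, if_true]
        rw [integral_const_mul, integral_tilt_mul_tilt hx hind h2 m1 m2 h h', if_neg hne.symm,
          mul_zero]
      · simp [h']
    · simp
  · simp [h]

/-- Orthogonality: the weighted second moment of the chaos. -/
lemma sum_integral_chaos_sq (hx : ∀ e, Measurable (x e)) (hind : iIndepFun x P)
    (h2 : ∀ e, Integrable (fun y => x e y ^ 2) P)
    (m1 : ∀ e, ∫ y, x e y ∂P = 1) (m2 : ∀ e, ∫ y, x e y ^ 2 ∂P = a)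
    (u : Finset E → ℝ) (K : ℝ) :
    ∫ y, ∑ Λ : Finset E, K ^ Λ.card * chaos u (fun e => x e y) Λ ^ 2 ∂P =
      ∑ Δ : Finset E, u Δ ^ 2 * (K * a + (a - 1)) ^ Δ.card := by
  classical
  rw [integral_finsetSum _ fun Λ _ => (integrable_chaos_sq hx hind h2 u Λ).const_mul _]
  simp only [integral_const_mul, integral_chaos_sq hx hind h2 m1 m2, Finset.mul_sum]
  rw [Finset.sum_comm]
  refine Finset.sum_congr rfl fun Δ _ => ?_
  -- After exchanging the sums, summing `(K a)^|Λ| (a - 1)^|Δ \ Λ|` over `Λ ⊆ Δ` is the binomial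
  -- theorem.
  rw [← Finset.sum_pow_mul_eq_add_pow, Finset.mul_sum]
  simp only [mul_ite, mul_zero]
  rw [← Finset.sum_filter]
  refine Finset.sum_congr (by ext; simp) fun Λ _ => ?_
  rw [mul_pow]; ring

end SecondMoment

/-! ### Inclusion probabilities compared with independent edges -/

section Counting

lemma sum_pow_card_le_exp {E : Type*} [Fintype E] (h : ℝ) (hh : 0 ≤ h) :
    ∑ Δ : Finset E, h ^ Δ.card ≤ Real.exp (Nat.card E * h) := by
  have := Fintype.sum_pow_mul_eq_add_pow E h 1
  simp only [one_pow, mul_one] at this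
  rw [this, Nat.card_eq_fintype_card, Real.exp_nat_mul]
  gcongr
  exact Real.add_one_le_exp h

-- Removing `e` and `f` is injective on the sets containing both and costs exactly `h ^ 2`.
open Classical in
lemma sum_pow_card_of_mem_le {E : Type*} [Fintype E] (h : ℝ) (hh : 0 ≤ h) {e f : E} (hef : e ≠ f) :
    (∑ Δ : Finset E, if e ∈ Δ ∧ f ∈ Δ then h ^ Δ.card else 0) ≤
      h ^ 2 * Real.exp (Nat.card E * h) := by
  have h1 : (∑ Δ : Finset E, if e ∈ Δ ∧ f ∈ Δ then h ^ Δ.card else 0) =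
      h ^ 2 * ∑ Δ : Finset E with e ∈ Δ ∧ f ∈ Δ, h ^ ((Δ.erase e).erase f).card := by
    rw [← Finset.sum_filter, Finset.mul_sum]
    refine Finset.sum_congr rfl fun Δ hΔ => ?_
    obtain ⟨he, hf⟩ := (Finset.mem_filter.1 hΔ).2
    have hf' : f ∈ Δ.erase e := Finset.mem_erase.2 ⟨hef.symm, hf⟩
    rw [← Finset.card_erase_add_one he, ← Finset.card_erase_add_one hf']
    ring
  rw [h1]
  refine mul_le_mul_of_nonneg_left ?_ (sq_nonneg h)
  refine le_trans ?_ (sum_pow_card_le_exp h hh)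
  rw [← Finset.sum_image (s := Finset.univ.filter fun Δ : Finset E => e ∈ Δ ∧ f ∈ Δ)
    (g := fun Δ => (Δ.erase e).erase f) (f := fun Δ => h ^ Δ.card)]
  · exact Finset.sum_le_sum_of_subset_of_nonneg (Finset.subset_univ _) fun _ _ _ => by positivity
  · intro Δ hΔ Δ' hΔ' heq
    obtain ⟨he, hf⟩ := (Finset.mem_filter.1 hΔ).2
    obtain ⟨he', hf'⟩ := (Finset.mem_filter.1 hΔ').2
    dsimp only at heq
    rw [← Finset.insert_erase he, ← Finset.insert_erase he',
      ← Finset.insert_erase (Finset.mem_erase.2 ⟨hef.symm, hf⟩),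
      ← Finset.insert_erase (Finset.mem_erase.2 ⟨hef.symm, hf'⟩), heq]

-- A set that is not a partial matching contains two distinct edges `vb`, `vc`; this is a union
-- bound over the triples `(v, b, c)`.
open Classical in
lemma sum_not_isPartialMatching_le {V : Type*} [Fintype V] (G : SimpleGraph V) (h : ℝ)
    (hh : 0 ≤ h) :
    (∑ Δ : Finset G.edgeSet, if IsPartialMatching Δ then 0 else h ^ Δ.card) ≤
      (Fintype.card V : ℝ) ^ 3 * (h ^ 2 * Real.exp (Nat.card G.edgeSet * h)) := by
  let T : V × V × V → Finset G.edgeSet → ℝ := fun t Δ =>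
    if t.2.1 ≠ t.2.2 ∧ (∃ e ∈ Δ, (e : Sym2 V) = s(t.1, t.2.1)) ∧
      (∃ f ∈ Δ, (f : Sym2 V) = s(t.1, t.2.2)) then h ^ Δ.card else 0
  have h1 : ∀ Δ : Finset G.edgeSet, (if IsPartialMatching Δ then 0 else h ^ Δ.card) ≤
      ∑ t, T t Δ := by
    intro Δ
    have hT : ∀ t, 0 ≤ T t Δ := fun t => by
      simp only [T]; split_ifs <;> positivity
    split_ifs with hm
    · exact Finset.sum_nonneg fun t _ => hT t
    · simp only [IsPartialMatching] at hm
      push Not at hm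
      obtain ⟨e, he, f, hf, hne, v, hve, hvf⟩ := hm
      obtain ⟨b, hb⟩ := hve
      obtain ⟨c, hc⟩ := hvf
      have : T (v, b, c) Δ = h ^ Δ.card := by
        simp only [T]
        rw [if_pos]
        refine ⟨?_, ⟨e, he, hb⟩, ⟨f, hf, hc⟩⟩
        rintro rfl
        exact hne (Subtype.ext (hb.trans hc.symm))
      rw [← this]
      exact Finset.single_le_sum (f := fun t => T t Δ) (fun t _ => hT t) (Finset.mem_univ _)
  have h2 : ∀ t, ∑ Δ, T t Δ ≤ h ^ 2 * Real.exp (Nat.card G.edgeSet * h) := by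
    rintro ⟨v, b, c⟩
    have hpos : 0 ≤ h ^ 2 * Real.exp (Nat.card G.edgeSet * h) := by positivity
    by_cases hbc : b ≠ c ∧ s(v, b) ∈ G.edgeSet ∧ s(v, c) ∈ G.edgeSet
    · obtain ⟨hne, hb, hc⟩ := hbc
      have hef : (⟨s(v, b), hb⟩ : G.edgeSet) ≠ ⟨s(v, c), hc⟩ := by
        intro hcon
        exact hne (Sym2.congr_right.1 (Subtype.ext_iff.1 hcon))
      refine le_trans (le_of_eq ?_) (sum_pow_card_of_mem_le h hh hef)
      refine Finset.sum_congr rfl fun Δ _ => ?_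
      simp only [T]
      have e1 : ∀ d (hd : s(v, d) ∈ G.edgeSet), (∃ e ∈ Δ, (e : Sym2 V) = s(v, d)) ↔
          (⟨s(v, d), hd⟩ : G.edgeSet) ∈ Δ := by
        intro d hd
        constructor
        · rintro ⟨e, he, hed⟩
          have : e = ⟨s(v, d), hd⟩ := Subtype.ext hed
          rwa [← this]
        · intro h; exact ⟨_, h, rfl⟩
      simp only [e1 b hb, e1 c hc, ne_eq, hne, not_false_eq_true, true_and]
      congr
    · refine le_trans (le_of_eq (Finset.sum_eq_zero fun Δ _ => ?_)) hpos
      simp only [T]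
      rw [if_neg]
      rintro ⟨hne, ⟨e, -, he⟩, f, -, hf⟩
      exact hbc ⟨hne, he ▸ e.2, hf ▸ f.2⟩
  calc _ ≤ ∑ Δ : Finset G.edgeSet, ∑ t, T t Δ := Finset.sum_le_sum fun Δ _ => h1 Δ
    _ = ∑ t, ∑ Δ, T t Δ := Finset.sum_comm
    _ ≤ ∑ t : V × V × V, h ^ 2 * Real.exp (Nat.card G.edgeSet * h) :=
      Finset.sum_le_sum fun t _ => h2 t
    _ = _ := by
      rw [Finset.sum_const, Finset.card_univ, Fintype.card_prod, Fintype.card_prod, nsmul_eq_mul]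
      push_cast
      ring

lemma unifProb_nonneg {E : Type*} (S : Finset (Finset E)) (Γ : Finset E) : 0 ≤ unifProb S Γ := by
  unfold unifProb; positivity

lemma unifProb_eq_zero {E : Type*} (S : Finset (Finset E)) (Γ : Finset E)
    (h : ¬ ∃ π ∈ S, Γ ⊆ π) : unifProb S Γ = 0 := by
  classical
  unfold unifProb
  rw [Finset.filter_eq_empty_iff.2 fun π hπ hΓ => h ⟨π, hπ, hΓ⟩]
  simp

/-- The common edge probability is `m / |E|`. -/
lemma edgeProb_eq {E : Type*} [Fintype E] (S : Finset (Finset E)) (hS : S.Nonempty) (m : ℕ)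
    (hm : ∀ π ∈ S, π.card = m) (hp : ∀ e f, edgeProb S e = edgeProb S f) (e : E) :
    edgeProb S e = m / Nat.card E := by
  classical
  -- Double counting: the edge probabilities sum to the mean size of `π`.
  have h1 : ∑ f, edgeProb S f = m := by
    simp only [edgeProb, unifProb, Finset.card_filter]
    rw [← Finset.sum_div]
    push_cast
    rw [Finset.sum_comm]
    have : ∀ π ∈ S, ∑ f : E, (if {f} ⊆ π then (1 : ℝ) else 0) = m := by
      intro π hπ
      simp only [Finset.singleton_subset_iff]
      rw [Finset.sum_ite_mem, Finset.univ_inter]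
      simp [hm π hπ]
    rw [div_eq_iff (by simpa using hS.ne_empty)]
    rw [← nsmul_eq_mul', ← Finset.sum_const]
    refine Finset.sum_congr rfl fun π hπ => ?_
    rw [← this π hπ]
  have h2 : ∑ f, edgeProb S f = Nat.card E * edgeProb S e := by
    rw [Finset.sum_congr rfl fun f _ => hp f e]
    simp
  have : (Nat.card E : ℝ) ≠ 0 := by
    have : Nonempty E := ⟨e⟩
    exact_mod_cast Nat.card_pos.ne'
  rw [eq_div_iff this, mul_comm, ← h2, h1]

open Classical in
/-- The inclusion probabilities are close to those of independent edges. -/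
lemma sum_unifProb_sub_pow_sq_le {V : Type*} [Fintype V] (G : SimpleGraph V)
    (S : Finset (Finset G.edgeSet)) (m : ℕ) (p ρ₁ ρ₂ L : ℝ) (hp : 0 < p) (hρ₂ : 0 ≤ ρ₂)
    (hL : 0 ≤ L) (hpe : ∀ e, edgeProb S e = p)
    (hmat : ∀ Γ : Finset G.edgeSet, IsPartialMatching Γ →
      |unifProb S Γ / (∏ e ∈ Γ, edgeProb S e) - 1| ≤ ρ₁ ^ Γ.card / √(m : ℝ))
    (hnon : ∀ Γ : Finset G.edgeSet, (∃ π ∈ S, Γ ⊆ π) → ¬ IsPartialMatching Γ →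
      unifProb S Γ ≤ ρ₂ ^ Γ.card * ∏ e ∈ Γ, edgeProb S e) :
    ∑ Δ : Finset G.edgeSet, (unifProb S Δ - p ^ Δ.card) ^ 2 * L ^ Δ.card ≤
      1 / m * Real.exp (Nat.card G.edgeSet * ((ρ₁ * p) ^ 2 * L)) +
      (Fintype.card V : ℝ) ^ 3 * ((((1 + ρ₂) * p) ^ 2 * L) ^ 2 *
        Real.exp (Nat.card G.edgeSet * (((1 + ρ₂) * p) ^ 2 * L))) := by
  simp only [hpe, Finset.prod_const] at hmat hnon
  have h1 : ∀ Δ : Finset G.edgeSet, (unifProb S Δ - p ^ Δ.card) ^ 2 * L ^ Δ.card ≤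
      1 / m * ((ρ₁ * p) ^ 2 * L) ^ Δ.card +
      (if IsPartialMatching Δ then 0 else (((1 + ρ₂) * p) ^ 2 * L) ^ Δ.card) := by
    intro Δ
    have hpk : 0 < p ^ Δ.card := pow_pos hp _
    have hLk : 0 ≤ L ^ Δ.card := pow_nonneg hL _
    rw [mul_pow, mul_pow _ L, ← pow_mul, ← pow_mul, mul_comm 2, pow_mul, pow_mul, mul_pow ρ₁,
      mul_pow (1 + ρ₂)]
    split_ifs with hm
    · rw [add_zero, ← mul_assoc]
      refine mul_le_mul_of_nonneg_right ?_ hLk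
      have h := hmat Δ hm
      have h2 : |unifProb S Δ - p ^ Δ.card| ≤ ρ₁ ^ Δ.card / √(m : ℝ) * p ^ Δ.card := by
        rw [div_sub_one hpk.ne', abs_div, abs_of_pos hpk, div_le_iff₀ hpk] at h
        exact h
      rw [← sq_abs]
      refine (pow_le_pow_left₀ (abs_nonneg _) h2 2).trans (le_of_eq ?_)
      rw [mul_pow, div_pow, Real.sq_sqrt (Nat.cast_nonneg m)]
      ring
    · have h0 : 0 ≤ (1 : ℝ) / m * (ρ₁ ^ Δ.card * p ^ Δ.card) ^ 2 := by positivity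
      -- The base `1 + ρ₂` dominates both `ρ₂` (for the inclusion probability) and 1 (for `p ^
      -- Δ.card`).
      have h3 : |unifProb S Δ - p ^ Δ.card| ≤ (1 + ρ₂) ^ Δ.card * p ^ Δ.card := by
        have hu := unifProb_nonneg S Δ
        have hle : unifProb S Δ ≤ ρ₂ ^ Δ.card * p ^ Δ.card := by
          by_cases hex : ∃ π ∈ S, Δ ⊆ π
          · exact hnon Δ hex hm
          · rw [unifProb_eq_zero S Δ hex]; positivity
        have e1 : ρ₂ ^ Δ.card ≤ (1 + ρ₂) ^ Δ.card := pow_le_pow_left₀ hρ₂ (by linarith) _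
        have e2 : 1 ≤ (1 + ρ₂) ^ Δ.card := one_le_pow₀ (by linarith)
        rw [abs_le]
        constructor <;> nlinarith
      have h4 := pow_le_pow_left₀ (abs_nonneg _) h3 2
      rw [sq_abs] at h4
      have h5 := mul_le_mul_of_nonneg_right h4 hLk
      nlinarith [mul_nonneg h0 hLk]
  refine (Finset.sum_le_sum fun Δ _ => h1 Δ).trans ?_
  rw [Finset.sum_add_distrib, ← Finset.mul_sum]
  refine add_le_add (mul_le_mul_of_nonneg_left (sum_pow_card_le_exp _ (by positivity))
    (by positivity)) (sum_not_isPartialMatching_le G _ (by positivity))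

end Counting

/-! ### Boltzmann factors and their moments -/

section Weights

/-- The Boltzmann factor `exp(-β x)` of a single weight, as a real number. -/
noncomputable def edgeFactor (β : ℝ) (x : EReal) : ℝ := (EReal.exp (-((β : EReal) * x))).toReal

lemma measurable_exp_neg_mul (β : ℝ) :
    Measurable fun x : EReal => EReal.exp (-((β : EReal) * x)) := by
  fun_prop

lemma measurable_edgeFactor (β : ℝ) : Measurable (edgeFactor β) :=
  (measurable_exp_neg_mul β).ennreal_toReal

lemma exp_neg_natCast_mul {β : ℝ} (hβ : 0 < β) {k : ℕ} (hk : k ≠ 0) (x : EReal) :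
    EReal.exp (-(((k * β : ℝ) : EReal) * x)) = EReal.exp (-((β : EReal) * x)) ^ k := by
  have hkβ : 0 < (k : ℝ) * β := by positivity
  induction x with
  | bot => rw [EReal.coe_mul_bot_of_pos hβ, EReal.coe_mul_bot_of_pos hkβ]; simp [hk]
  | top => rw [EReal.coe_mul_top_of_pos hβ, EReal.coe_mul_top_of_pos hkβ]; simp [hk]
  | coe x =>
    rw [← EReal.coe_mul, ← EReal.coe_mul, ← EReal.coe_neg, ← EReal.coe_neg, EReal.exp_coe,
      EReal.exp_coe, ← ENNReal.ofReal_pow (Real.exp_pos _).le, ← Real.exp_nat_mul]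
    congr 2; ring

lemma boltzmann_eq_prod {E : Type*} {β : ℝ} (hβ : 0 < β) (w : E → EReal) (hw : ∀ e, w e ≠ ⊥)
    (π : Finset E) : boltzmann β w π = ∏ e ∈ π, edgeFactor β (w e) := by
  classical
  -- The identity is proved in `ℝ≥0∞`, where it would fail for `⊤ + ⊥ = ⊥`; hence the induction also
  -- carries that partial sums are not `⊥`.
  have h : ∀ π : Finset E, totalWeight w π ≠ ⊥ ∧ EReal.exp (-((β : EReal) * totalWeight w π)) =
      ∏ e ∈ π, EReal.exp (-((β : EReal) * w e)) := by
    intro π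
    induction π using Finset.induction_on with
    | empty => simp [totalWeight]
    | insert e π he ih =>
      obtain ⟨h1, h2⟩ := ih
      have h3 : totalWeight w (insert e π) = w e + totalWeight w π := Finset.sum_insert he
      rw [h3, Finset.prod_insert he, ← h2]
      have h4 := hw e
      generalize w e = s at *
      generalize totalWeight w π = t at *
      have hb : (0 : ℝ) < β := hβ
      induction s with
      | bot => exact absurd rfl h4
      | top =>
        rw [EReal.top_add_of_ne_bot h1, EReal.coe_mul_top_of_pos hb]
        simp
      | coe s =>
        induction t with
        | bot => exact absurd rfl h1
        | top =>
          rw [EReal.coe_add_top, EReal.coe_mul_top_of_pos hb]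
          simp
        | coe t =>
          refine ⟨by rw [← EReal.coe_add]; exact EReal.coe_ne_bot _, ?_⟩
          rw [← EReal.exp_add]
          congr 1
          norm_cast
          ring
  rw [boltzmann, (h π).2, ENNReal.toReal_prod]
  rfl

variable {ν : Measure EReal}

lemma ae_ne_bot_of_laplace {β : ℝ} (hβ : 0 < β) (h : laplace ν β < ∞) : ∀ᵐ x ∂ν, x ≠ ⊥ := by
  filter_upwards [ae_lt_top (measurable_exp_neg_mul β) h.ne] with x hx hbot
  rw [hbot, EReal.coe_mul_bot_of_pos hβ] at hx
  simp at hx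

lemma laplace_pos [IsProbabilityMeasure ν] {β : ℝ} (hβ : 0 < β) (h : ν {⊤} < 1) :
    0 < laplace ν β := by
  rw [pos_iff_ne_zero]
  intro h0
  rw [laplace, lintegral_eq_zero_iff (measurable_exp_neg_mul β)] at h0
  refine h.ne ?_
  rw [← mem_ae_iff_prob_eq_one (measurableSet_singleton _)]
  filter_upwards [h0] with x hx
  simp only [Pi.zero_apply, EReal.exp_eq_zero_iff, EReal.neg_eq_bot_iff] at hx
  induction x with
  | bot => rw [EReal.coe_mul_bot_of_pos hβ] at hx; exact absurd hx (by simp)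
  | top => rfl
  | coe x => rw [← EReal.coe_mul] at hx; exact absurd hx (EReal.coe_ne_top _)

variable {Ω : Type*} [MeasurableSpace Ω] {P : Measure Ω}

lemma lintegral_exp_neg_mul {X : Ω → EReal} (hX : Measurable X) (hlaw : P.map X = ν) (β : ℝ) :
    ∫⁻ y, EReal.exp (-((β : EReal) * X y)) ∂P = laplace ν β := by
  rw [laplace, ← hlaw, lintegral_map (measurable_exp_neg_mul β) hX]

lemma integrable_edgeFactor_pow {X : Ω → EReal} (hX : Measurable X) (hlaw : P.map X = ν) {β : ℝ}
    (hβ : 0 < β) (hfin : ∀ β : ℝ, 0 < β → laplace ν β < ∞) {k : ℕ} (hk : k ≠ 0) :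
    Integrable (fun y => edgeFactor β (X y) ^ k) P ∧
      ∫ y, edgeFactor β (X y) ^ k ∂P = (laplace ν (k * β)).toReal := by
  have hkβ : 0 < (k : ℝ) * β := by positivity
  have e : (fun y => edgeFactor β (X y) ^ k) =
      fun y => (EReal.exp (-(((k * β : ℝ) : EReal) * X y))).toReal := by
    funext y
    rw [exp_neg_natCast_mul hβ hk, ENNReal.toReal_pow, edgeFactor]
  have hm : Measurable fun y => EReal.exp (-(((k * β : ℝ) : EReal) * X y)) :=
    (measurable_exp_neg_mul (k * β)).comp hX
  have hlt : ∫⁻ y, EReal.exp (-(((k * β : ℝ) : EReal) * X y)) ∂P < ∞ := by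
    rw [lintegral_exp_neg_mul hX hlaw]; exact hfin _ hkβ
  rw [e]
  refine ⟨integrable_toReal_of_lintegral_ne_top hm.aemeasurable hlt.ne, ?_⟩
  rw [integral_toReal hm.aemeasurable (ae_lt_top hm hlt.ne)]
  exact congrArg _ (lintegral_exp_neg_mul hX hlaw _)

/-- Dividing every edge factor by `c` scales all Boltzmann weights by the same `c ^ m`, which
cancels. The choice of interest for `c` is the mean of the edge factor. -/
lemma overlapAverage_eq {E : Type*} [Fintype E] (S : Finset (Finset E)) (m : ℕ)
    (hS : ∀ π ∈ S, π.card = m) {β : ℝ} (hβ : 0 < β) (w : E → EReal) (hw : ∀ e, w e ≠ ⊥) {c : ℝ}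
    (hc : 0 < c) (f : ℕ → ℝ) :
    overlapAverage S β w f =
      (∑ Λ : Finset E, (fwdDiff 1)^[Λ.card] f 0 *
          chaos (unifProb S) (fun e => edgeFactor β (w e) / c) Λ ^ 2) /
        chaos (unifProb S) (fun e => edgeFactor β (w e) / c) ∅ ^ 2 := by
  classical
  have hb : ∀ π ∈ S, boltzmann β w π = c ^ m * ∏ e ∈ π, edgeFactor β (w e) / c := by
    intro π hπ
    rw [boltzmann_eq_prod hβ w hw, Finset.prod_div_distrib, Finset.prod_const, hS π hπ]
    field_simp
  have hZ : partitionFn S β w =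
      c ^ m * chaos (unifProb S) (fun e => edgeFactor β (w e) / c) ∅ := by
    rw [chaos_unifProb, partitionFn, Finset.sum_congr rfl hb, ← Finset.mul_sum]
    simp; ring
  rw [sum_fwdDiff_mul_chaos_sq, overlapAverage]
  set ζ := chaos (unifProb S) (fun e => edgeFactor β (w e) / c) ∅
  rw [Finset.mul_sum, Finset.sum_div]
  refine Finset.sum_congr rfl fun π hπ => ?_
  rw [Finset.mul_sum, Finset.sum_div]
  refine Finset.sum_congr rfl fun π' hπ' => ?_
  rw [gibbsProb, gibbsProb, hb π hπ, hb π' hπ', hZ]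
  have hcm : c ^ m ≠ 0 := by positivity
  -- This also covers `ζ = 0`, where division by zero makes both sides 0.
  have : ∀ A B : ℝ, 1 / (c ^ m * ζ) * A * (c ^ m * B) = 1 / ζ * A * B := by
    intro A B
    rw [one_div, mul_inv, one_div]
    field_simp
  rw [this, this]
  rw [one_div ζ, div_eq_mul_inv _ (ζ ^ 2), ← inv_pow]
  ring

end Weights

/-! ### Deterministic stability of the ratio -/

section Comparison

/-- Write `z² - b² = (z - b)² + 2b(z - b)` and apply the weighted arithmetic-geometric inequality to
the cross term. -/
lemma abs_sq_sub_sq_le (z b : ℝ) {η : ℝ} (hη : 0 < η) :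
    |z ^ 2 - b ^ 2| ≤ (1 + 1 / η) * (z - b) ^ 2 + η * b ^ 2 := by
  have h : 2 * |b * (z - b)| ≤ 1 / η * (z - b) ^ 2 + η * b ^ 2 := by
    have h1 : 0 ≤ (1 / η) * (|z - b| - η * |b|) ^ 2 := by positivity
    have h2 : (1 / η) * (|z - b| - η * |b|) ^ 2 =
        1 / η * |z - b| ^ 2 + η * |b| ^ 2 - 2 * (|b| * |z - b|) := by
      field_simp; ring
    rw [h2, sq_abs, sq_abs] at h1
    rw [abs_mul]; linarith
  have e : z ^ 2 - b ^ 2 = (z - b) ^ 2 + 2 * (b * (z - b)) := by ring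
  rw [e]
  refine (abs_add_le _ _).trans ?_
  rw [abs_of_nonneg (sq_nonneg _), abs_mul, abs_two]
  linarith

variable {E : Type*} [Fintype E]

lemma single_le_weighted_sum (K : ℝ) (hK : 0 ≤ K) (v : Finset E → ℝ) (w : E → ℝ) :
    chaos v w ∅ ^ 2 ≤ ∑ Λ : Finset E, K ^ Λ.card * chaos v w Λ ^ 2 := by
  have := Finset.single_le_sum (f := fun Λ : Finset E => K ^ Λ.card * chaos v w Λ ^ 2)
    (fun Λ _ => by positivity) (Finset.mem_univ ∅)
  simpa using this

/-- The term `Λ = ∅` of the weighted sum in `hU` bounds the change of the partition function by `κ`,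
so the denominator stays above `κ ^ 2`. The numerator is controlled termwise by `abs_sq_sub_sq_le`;
`η` balances the small distance against the merely bounded size. -/
lemma abs_div_chaos_sq_sub_le (g : ℕ → ℝ) (C K : ℝ) (hK : 0 ≤ K)
    (hg : ∀ k, |g k| ≤ C * K ^ k) (u v : Finset E → ℝ) (w : E → ℝ) (F Q η κ : ℝ) (hη : 0 < η)
    (hκ : 0 < κ)
    (hQ : ∑ Λ : Finset E, g Λ.card * chaos v w Λ ^ 2 = chaos v w ∅ ^ 2 * Q)
    (hΞ : 2 * κ ≤ chaos v w ∅)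
    (hU : ∑ Λ : Finset E, K ^ Λ.card * chaos (fun Δ => u Δ - v Δ) w Λ ^ 2 ≤ κ ^ 2) :
    |(∑ Λ : Finset E, g Λ.card * chaos u w Λ ^ 2) / chaos u w ∅ ^ 2 - F| ≤
      ((C + |F|) * ((1 + 1 / η) * ∑ Λ : Finset E, K ^ Λ.card * chaos (fun Δ => u Δ - v Δ) w Λ ^ 2 +
          η * ∑ Λ : Finset E, K ^ Λ.card * chaos v w Λ ^ 2) +
        (∑ Λ : Finset E, K ^ Λ.card * chaos v w Λ ^ 2) * |Q - F|) / κ ^ 2 := by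
  have hC : 0 ≤ C := by have := (abs_nonneg _).trans (hg 0); simpa using this
  have hU0 := single_le_weighted_sum K hK (fun Δ => u Δ - v Δ) w
  have hT0 := single_le_weighted_sum K hK v w
  have hH : |∑ Λ : Finset E, g Λ.card * chaos u w Λ ^ 2 -
      ∑ Λ : Finset E, g Λ.card * chaos v w Λ ^ 2| ≤ C *
        ((1 + 1 / η) * ∑ Λ : Finset E, K ^ Λ.card * chaos (fun Δ => u Δ - v Δ) w Λ ^ 2 +
          η * ∑ Λ : Finset E, K ^ Λ.card * chaos v w Λ ^ 2) := by
    rw [← Finset.sum_sub_distrib, Finset.mul_sum, Finset.mul_sum, ← Finset.sum_add_distrib,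
      Finset.mul_sum]
    refine (Finset.abs_sum_le_sum_abs _ _).trans (Finset.sum_le_sum fun Λ _ => ?_)
    rw [← mul_sub, abs_mul, chaos_sub]
    refine (mul_le_mul (hg _) (abs_sq_sub_sq_le _ _ hη) (abs_nonneg _) (by positivity)).trans
      (le_of_eq (by ring))
  set U := ∑ Λ : Finset E, K ^ Λ.card * chaos (fun Δ => u Δ - v Δ) w Λ ^ 2
  set T := ∑ Λ : Finset E, K ^ Λ.card * chaos v w Λ ^ 2
  set H := ∑ Λ : Finset E, g Λ.card * chaos u w Λ ^ 2
  set ζ := chaos u w ∅ with hζ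
  set Ξ := chaos v w ∅ with hXi
  rw [chaos_sub, ← hζ, ← hXi] at hU0
  have hd : |ζ - Ξ| ≤ κ := abs_le_of_sq_le_sq (hU0.trans hU) hκ.le
  have hζκ : κ ≤ ζ := by have := (abs_le.1 hd).1; linarith
  have h2 : |ζ ^ 2 - Ξ ^ 2| ≤ (1 + 1 / η) * U + η * T :=
    (abs_sq_sub_sq_le ζ Ξ hη).trans (add_le_add
      (mul_le_mul_of_nonneg_left hU0 (by positivity)) (mul_le_mul_of_nonneg_left hT0 hη.le))
  have hζpos : 0 < ζ ^ 2 := by have := hκ.trans_le hζκ; positivity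
  have hκζ : κ ^ 2 ≤ ζ ^ 2 := pow_le_pow_left₀ hκ.le hζκ 2
  have e : H / ζ ^ 2 - F =
      ((H - Ξ ^ 2 * Q) + Ξ ^ 2 * (Q - F) - F * (ζ ^ 2 - Ξ ^ 2)) / ζ ^ 2 := by
    rw [eq_div_iff hζpos.ne', sub_mul, div_mul_cancel₀ _ hζpos.ne']; ring
  rw [hQ] at hH
  have hnum : |(H - Ξ ^ 2 * Q) + Ξ ^ 2 * (Q - F) - F * (ζ ^ 2 - Ξ ^ 2)| ≤
      (C + |F|) * ((1 + 1 / η) * U + η * T) + T * |Q - F| := by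
    refine (abs_sub _ _).trans ?_
    refine (add_le_add_left (abs_add_le _ _) _).trans ?_
    rw [abs_mul F, abs_mul (Ξ ^ 2), abs_of_nonneg (sq_nonneg Ξ)]
    have a1 := mul_le_mul_of_nonneg_left h2 (abs_nonneg F)
    have a2 := mul_le_mul_of_nonneg_right hT0 (abs_nonneg (Q - F))
    linarith
  rw [e, abs_div, abs_of_pos hζpos]
  exact div_le_div₀ ((abs_nonneg _).trans hnum) hnum (by positivity) hκζ

end Comparison

/-! ### The model with independent edges -/

section ProductMeasure

/-- The squared probability of an edge under the product Gibbs measure with weight `t`. -/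
noncomputable def pairProb (p t : ℝ) : ℝ := (p * t / (1 + p * (t - 1))) ^ 2

lemma pairProb_nonneg (p t : ℝ) : 0 ≤ pairProb p t := sq_nonneg _

lemma half_le_one_add {p t : ℝ} (hp : 0 ≤ p) (hp2 : p ≤ 1 / 2) (ht : 0 ≤ t) :
    1 / 2 ≤ 1 + p * (t - 1) := by nlinarith

lemma pairProb_sq_le {p t : ℝ} (hp : 0 ≤ p) (hp2 : p ≤ 1 / 2) (ht : 0 ≤ t) :
    pairProb p t ^ 2 ≤ 16 * p ^ 4 * t ^ 4 := by
  have hD := half_le_one_add hp hp2 ht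
  have h1 : p * t / (1 + p * (t - 1)) ≤ 2 * (p * t) := by
    rw [div_le_iff₀ (by linarith)]
    nlinarith [mul_nonneg hp ht]
  have h0 : 0 ≤ p * t / (1 + p * (t - 1)) := div_nonneg (mul_nonneg hp ht) (by linarith)
  rw [pairProb, ← pow_mul]
  refine (pow_le_pow_left₀ h0 h1 4).trans (le_of_eq (by ring))

/-- The denominator `D` differs from 1 by at most `p * (t + 1)` and is at least `1 / 2`, so the
relative error has order `p`. -/
lemma abs_pairProb_sub_le {p t : ℝ} (hp : 0 ≤ p) (hp2 : p ≤ 1 / 2) (ht : 0 ≤ t) :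
    |pairProb p t - p ^ 2 * t ^ 2| ≤ 6 * p ^ 3 * (t ^ 3 + t ^ 2) := by
  have hD := half_le_one_add hp hp2 ht
  set D := 1 + p * (t - 1) with hDdef
  have hD0 : 0 < D := by linarith
  have e : pairProb p t - p ^ 2 * t ^ 2 = p ^ 2 * t ^ 2 * ((1 - D) * (1 + D) / D ^ 2) := by
    rw [pairProb, ← hDdef]; field_simp; ring
  have h1 : |1 - D| ≤ p * (t + 1) := by
    rw [hDdef, abs_le]; constructor <;> nlinarith [mul_nonneg hp ht]
  have h2 : |(1 - D) * (1 + D) / D ^ 2| ≤ 6 * (p * (t + 1)) := by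
    rw [abs_div, abs_mul, abs_of_pos (by positivity : 0 < D ^ 2),
      abs_of_pos (by linarith : 0 < 1 + D), div_le_iff₀ (by positivity)]
    have h3 : 1 + D ≤ 6 * D ^ 2 := by nlinarith
    calc _ ≤ p * (t + 1) * (6 * D ^ 2) := mul_le_mul h1 h3 (by linarith) (by positivity)
      _ = _ := by ring
  rw [e, abs_mul, abs_of_nonneg (by positivity : 0 ≤ p ^ 2 * t ^ 2)]
  refine (mul_le_mul_of_nonneg_left h2 (by positivity)).trans (le_of_eq (by ring))

variable {E : Type*} [Fintype E]

lemma chaos_pow_card_empty (p : ℝ) (w : E → ℝ) :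
    chaos (fun Δ => p ^ Δ.card) w ∅ = ∏ e, (1 + p * (w e - 1)) := by
  have := chaos_prod (fun _ => p) w ∅
  simpa using this

/-- For coefficients `p ^ Δ.card` the chaos is a product over edges; passing from `∅` to `Λ`
replaces `1 + p * (w e - 1)` by `p * w e` on `Λ`. -/
lemma chaos_pow_card {p : ℝ} (hp : 0 ≤ p) (hp2 : p ≤ 1 / 2) (w : E → ℝ) (hw : ∀ e, 0 ≤ w e)
    (Λ : Finset E) : chaos (fun Δ => p ^ Δ.card) w Λ =
      chaos (fun Δ => p ^ Δ.card) w ∅ * ∏ e ∈ Λ, (p * w e / (1 + p * (w e - 1))) := by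
  classical
  rw [chaos_pow_card_empty]
  have := chaos_prod (fun _ => p) w Λ
  simp only [Finset.prod_const] at this
  rw [this, ← Finset.univ_inter Λ, ← Finset.prod_ite_mem, ← Finset.prod_mul_distrib,
    Finset.univ_inter]
  refine Finset.prod_congr rfl fun e _ => ?_
  have hD : 1 + p * (w e - 1) ≠ 0 := by have := half_le_one_add hp hp2 (hw e); linarith
  split_ifs
  · field_simp
  · simp

lemma sum_mul_chaos_pow_card_sq {p : ℝ} (hp : 0 ≤ p) (hp2 : p ≤ 1 / 2) (w : E → ℝ)
    (hw : ∀ e, 0 ≤ w e) (g : ℕ → ℝ) :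
    ∑ Λ : Finset E, g Λ.card * chaos (fun Δ => p ^ Δ.card) w Λ ^ 2 =
      chaos (fun Δ => p ^ Δ.card) w ∅ ^ 2 *
        ∑ Λ : Finset E, g Λ.card * ∏ e ∈ Λ, pairProb p (w e) := by
  rw [Finset.mul_sum]
  refine Finset.sum_congr rfl fun Λ _ => ?_
  rw [chaos_pow_card hp hp2 w hw Λ, mul_pow, ← Finset.prod_pow]
  simp only [pairProb]
  ring

/-- The linear term `y` in the exponent is bounded below by `-(1 + y²)`, making the exponent minus a
nonnegative quantity to which Markov's inequality applies. -/
lemma exp_le_chaos_pow_card_empty {p : ℝ} (hp : 0 ≤ p) (hp2 : p ≤ 1 / 2) (w : E → ℝ)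
    (hw : ∀ e, 0 ≤ w e) :
    Real.exp (-(1 + (p * ∑ e, (w e - 1)) ^ 2 + 2 * p ^ 2 * ∑ e, (w e - 1) ^ 2)) ≤
      chaos (fun Δ => p ^ Δ.card) w ∅ := by
  have h1 : Real.exp (p * ∑ e, (w e - 1) - 2 * p ^ 2 * ∑ e, (w e - 1) ^ 2) ≤
      ∏ e, (1 + p * (w e - 1)) := by
    rw [Finset.mul_sum, Finset.mul_sum, ← Finset.sum_sub_distrib, Real.exp_sum]
    refine Finset.prod_le_prod (fun e _ => (Real.exp_pos _).le) fun e _ => ?_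
    have := exp_sub_two_mul_sq_le (p * (w e - 1))
      (by have := half_le_one_add hp hp2 (hw e); linarith)
    rwa [mul_pow, ← mul_assoc] at this
  rw [chaos_pow_card_empty]
  refine le_trans (Real.exp_le_exp.2 ?_) h1
  nlinarith [sq_nonneg (p * ∑ e, (w e - 1) + 1)]

end ProductMeasure

/-! ### Markov and variance bounds -/

section Markov

variable {Ω : Type*} [MeasurableSpace Ω] {P : Measure Ω}

lemma measureReal_le_div {f : Ω → ℝ} (hf : ∀ y, 0 ≤ f y) (hi : Integrable f P) {b ε : ℝ}
    (hb : ∫ y, f y ∂P ≤ b) (hε : 0 < ε) : P.real {y | ε ≤ f y} ≤ b / ε := by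
  rw [le_div_iff₀ hε, mul_comm]
  exact (mul_meas_ge_le_integral_of_nonneg (ae_of_all _ hf) hi ε).trans hb

lemma tendsto_measureReal_of_integral_le {X : ℕ → Ω → ℝ} {b : ℕ → ℝ}
    (h : ∀ᶠ n in atTop, (∀ y, 0 ≤ X n y) ∧ Integrable (X n) P ∧ ∫ y, X n y ∂P ≤ b n)
    (hb : Tendsto b atTop (𝓝 0)) {ε : ℝ} (hε : 0 < ε) :
    Tendsto (fun n => P.real {y | ε ≤ X n y}) atTop (𝓝 0) := by
  have hb' : Tendsto (fun n => b n / ε) atTop (𝓝 0) := by simpa using hb.div_const ε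
  refine tendsto_of_tendsto_of_tendsto_of_le_of_le' tendsto_const_nhds hb'
    (Eventually.of_forall fun n => measureReal_nonneg) ?_
  filter_upwards [h] with n hn
  exact measureReal_le_div hn.1 hn.2.1 hn.2.2 hε

lemma tendsto_measureReal_mono [IsFiniteMeasure P] {A B : ℕ → Set Ω} (h : ∀ᶠ n in atTop, A n ⊆ B n)
    (hB : Tendsto (fun n => P.real (B n)) atTop (𝓝 0)) :
    Tendsto (fun n => P.real (A n)) atTop (𝓝 0) := by
  refine tendsto_of_tendsto_of_tendsto_of_le_of_le' tendsto_const_nhds hB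
    (Eventually.of_forall fun n => measureReal_nonneg) ?_
  filter_upwards [h] with n hn
  exact measureReal_mono hn

lemma tendsto_measureReal_union {A B : ℕ → Set Ω}
    (hA : Tendsto (fun n => P.real (A n)) atTop (𝓝 0))
    (hB : Tendsto (fun n => P.real (B n)) atTop (𝓝 0)) :
    Tendsto (fun n => P.real (A n ∪ B n)) atTop (𝓝 0) := by
  refine tendsto_of_tendsto_of_tendsto_of_le_of_le tendsto_const_nhds
    (by simpa using hA.add hB) (fun n => measureReal_nonneg) fun n => measureReal_union_le _ _

lemma sum_sub_sq_integral [IsProbabilityMeasure P] {E : Type*} [Fintype E] {Y : E → Ω → ℝ} (hY : ∀ e, Measurable (Y e))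
    (hind : iIndepFun Y P) (h2 : ∀ e, Integrable (fun y => Y e y ^ 2) P) {μ v : ℝ}
    (m1 : ∀ e, ∫ y, Y e y ∂P = μ) (m2 : ∀ e, ∫ y, Y e y ^ 2 ∂P = v) :
    Integrable (fun y => (∑ e, (Y e y - μ)) ^ 2) P ∧
      ∫ y, (∑ e, (Y e y - μ)) ^ 2 ∂P = Nat.card E * (v - μ ^ 2) := by
  have hL : ∀ e, MemLp (Y e) 2 P := fun e =>
    (memLp_two_iff_integrable_sq (hY e).aestronglyMeasurable).2 (h2 e)
  have hLs : MemLp (∑ e, Y e) 2 P := memLp_finsetSum' _ fun e _ => hL e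
  have hmean : ∫ y, (∑ e, Y e) y ∂P = Nat.card E * μ := by
    simp only [Finset.sum_apply]
    rw [integral_finsetSum _ fun e _ => (hL e).integrable (by norm_num)]
    simp [m1]
  have hfun : (fun y => (∑ e, (Y e y - μ)) ^ 2) =
      fun y => ((∑ e, Y e) y - ∫ z, (∑ e, Y e) z ∂P) ^ 2 := by
    funext y
    rw [hmean, Finset.sum_sub_distrib, Finset.sum_apply]
    simp
  rw [hfun]
  refine ⟨(hLs.sub (memLp_const _)).integrable_sq, ?_⟩
  rw [← variance_eq_integral hLs.aestronglyMeasurable.aemeasurable, IndepFun.variance_sum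
    (fun e _ => hL e) (fun i _ j _ hij => hind.indepFun hij)]
  simp only [variance_eq_sub (hL _), m1]
  simp [m2]
  ring

end Markov

/-! ### Limits in probability for normalized factors -/

section Limit

/-- Normalized edge factors: for each `n`, independent nonnegative variables with common moments
`M k`, and edge probabilities `p n → 0` with `|E n| (p n)² → l`. -/
structure NormalizedFactors {E : ℕ → Type*} [∀ n, Fintype (E n)] {Ω : Type*} [MeasurableSpace Ω]
    (P : Measure Ω) (x : ∀ n, E n → Ω → ℝ) (M : ℕ → ℝ) (p : ℕ → ℝ) (l : ℝ) : Prop where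
  measurable : ∀ n e, Measurable (x n e)
  indep : ∀ n, iIndepFun (x n) P
  nonneg : ∀ n e y, 0 ≤ x n e y
  integrable : ∀ k, k ≠ 0 → ∀ n e, Integrable (fun y => x n e y ^ k) P
  moment : ∀ k, k ≠ 0 → ∀ n e, ∫ y, x n e y ^ k ∂P = M k
  moment_one : M 1 = 1
  one_le_moment_two : 1 ≤ M 2
  prob_pos : ∀ᶠ n in atTop, 0 < p n
  prob_tendsto : Tendsto p atTop (𝓝 0)
  card_tendsto : Tendsto (fun n => (Nat.card (E n) : ℝ) * p n ^ 2) atTop (𝓝 l)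

variable {E : ℕ → Type*} [∀ n, Fintype (E n)] {Ω : Type*} [MeasurableSpace Ω]
  {P : Measure Ω} {x : ∀ n, E n → Ω → ℝ} {M : ℕ → ℝ} {p : ℕ → ℝ} {l : ℝ}

namespace NormalizedFactors

lemma integral_eq_one (h : NormalizedFactors P x M p l) (n : ℕ) (e : E n) :
    ∫ y, x n e y ∂P = 1 := by
  simpa [h.moment_one] using h.moment 1 one_ne_zero n e

lemma eventually_le_half (h : NormalizedFactors P x M p l) : ∀ᶠ n in atTop, p n ≤ 1 / 2 :=
  h.prob_tendsto.eventually_le_const (by norm_num)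

lemma limit_nonneg (h : NormalizedFactors P x M p l) : 0 ≤ l :=
  ge_of_tendsto' h.card_tendsto fun n => by positivity

variable [IsProbabilityMeasure P]

lemma tendsto_sum_pairProb_sq (h : NormalizedFactors P x M p l) {ε : ℝ} (hε : 0 < ε) :
    Tendsto (fun n => P.real {y | ε ≤ ∑ e, pairProb (p n) (x n e y) ^ 2}) atTop (𝓝 0) := by
  have hb : Tendsto (fun n => 16 * ((Nat.card (E n) : ℝ) * p n ^ 2) * p n ^ 2 * M 4) atTop
      (𝓝 0) := by
    have := (((h.card_tendsto.const_mul 16).mul (h.prob_tendsto.pow 2)).mul_const (M 4))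
    simpa using this
  refine tendsto_measureReal_mono ?_ (tendsto_measureReal_of_integral_le
    (X := fun n y => ∑ e, 16 * p n ^ 4 * x n e y ^ 4) (Eventually.of_forall fun n => ⟨?_, ?_, ?_⟩)
    hb hε)
  · filter_upwards [h.prob_pos, h.eventually_le_half] with n h1 h2 y hy
    exact le_trans hy (Finset.sum_le_sum fun e _ => pairProb_sq_le h1.le h2 (h.nonneg n e y))
  · intro y
    exact Finset.sum_nonneg fun e _ => by have := h.nonneg n e y; positivity
  · exact integrable_finsetSum _ fun e _ => (h.integrable 4 (by norm_num) n e).const_mul _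
  · rw [integral_finsetSum _ fun e _ => (h.integrable 4 (by norm_num) n e).const_mul _]
    simp only [integral_const_mul, h.moment 4 (by norm_num)]
    rw [Finset.sum_const, nsmul_eq_mul, Finset.card_univ, Nat.card_eq_fintype_card]
    exact le_of_eq (by ring)

/-- Law of large numbers with three errors: replacing `pairProb` by `p² x²` costs `O(|E| p³)` in
`L¹`, the centered sum has variance `|E| p⁴ (M 4 - M 2 ^ 2)`, and the mean `|E| p² M 2` converges.
-/
lemma tendsto_sum_pairProb (h : NormalizedFactors P x M p l) {ε : ℝ} (hε : 0 < ε) :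
    Tendsto (fun n => P.real {y | ε ≤ |∑ e, pairProb (p n) (x n e y) - l * M 2|}) atTop (𝓝 0) := by
  have hb1 : Tendsto (fun n => 6 * ((Nat.card (E n) : ℝ) * p n ^ 2) * p n * (M 3 + M 2)) atTop
      (𝓝 0) := by
    have := (((h.card_tendsto.const_mul 6).mul h.prob_tendsto).mul_const (M 3 + M 2))
    simpa using this
  have hb2 : Tendsto (fun n => ((Nat.card (E n) : ℝ) * p n ^ 2) * p n ^ 2 * (M 4 - M 2 ^ 2)) atTop
      (𝓝 0) := by
    have := ((h.card_tendsto.mul (h.prob_tendsto.pow 2)).mul_const (M 4 - M 2 ^ 2))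
    simpa using this
  have h3i : ∀ n e, Integrable (fun y => x n e y ^ 3 + x n e y ^ 2) P := fun n e =>
    (h.integrable 3 (by norm_num) n e).add (h.integrable 2 (by norm_num) n e)
  have hA1 := tendsto_measureReal_of_integral_le (P := P)
    (X := fun n y => |∑ e, 6 * p n ^ 3 * (x n e y ^ 3 + x n e y ^ 2)|)
    (b := fun n => 6 * ((Nat.card (E n) : ℝ) * p n ^ 2) * p n * (M 3 + M 2))
    (by
      filter_upwards [h.prob_pos] with n hp
      have h0 : ∀ y, 0 ≤ ∑ e, 6 * p n ^ 3 * (x n e y ^ 3 + x n e y ^ 2) := fun y =>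
        Finset.sum_nonneg fun e _ => by have := h.nonneg n e y; positivity
      simp only [abs_of_nonneg (h0 _)]
      refine ⟨h0, integrable_finsetSum _ fun e _ => (h3i n e).const_mul _, ?_⟩
      rw [integral_finsetSum _ fun e _ => (h3i n e).const_mul _]
      simp only [integral_const_mul]
      rw [Finset.sum_congr rfl fun e _ => by
        rw [integral_add (h.integrable 3 (by norm_num) n e) (h.integrable 2 (by norm_num) n e),
          h.moment 3 (by norm_num), h.moment 2 (by norm_num)],
        Finset.sum_const, nsmul_eq_mul, Finset.card_univ, Nat.card_eq_fintype_card]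
      exact le_of_eq (by ring)) hb1 (ε := ε / 3) (by positivity)
  have hA2 := tendsto_measureReal_of_integral_le (P := P)
    (X := fun n y => (p n ^ 2 * ∑ e, (x n e y ^ 2 - M 2)) ^ 2)
    (b := fun n => ((Nat.card (E n) : ℝ) * p n ^ 2) * p n ^ 2 * (M 4 - M 2 ^ 2))
    (Eventually.of_forall fun n => by
      obtain ⟨i1, i2⟩ := sum_sub_sq_integral (P := P) (Y := fun e y => x n e y ^ 2)
        (fun e => (h.measurable n e).pow_const 2)
        ((h.indep n).comp (fun _ t => t ^ 2) fun _ => measurable_id.pow_const 2)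
        (fun e => by simpa only [← pow_mul] using h.integrable 4 (by norm_num) n e)
        (fun e => h.moment 2 (by norm_num) n e) (v := M 4)
        (fun e => by simpa only [← pow_mul] using h.moment 4 (by norm_num) n e)
      refine ⟨fun y => sq_nonneg _, ?_, ?_⟩
      · simp only [mul_pow]
        exact i1.const_mul _
      · simp only [mul_pow]
        rw [integral_const_mul, i2]
        exact le_of_eq (by ring)) hb2 (ε := (ε / 3) ^ 2) (by positivity)
  refine tendsto_measureReal_mono ?_ (tendsto_measureReal_union hA1 hA2)
  have hdet : ∀ᶠ n in atTop, |(Nat.card (E n) : ℝ) * p n ^ 2 * M 2 - l * M 2| < ε / 3 := by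
    have := (h.card_tendsto.mul_const (M 2)).eventually
      (Metric.ball_mem_nhds _ (by positivity : 0 < ε / 3))
    simpa [Real.dist_eq] using this
  filter_upwards [h.prob_pos, h.eventually_le_half, hdet] with n h1 h2 h3 y hy
  by_contra hcon
  simp only [Set.mem_union, Set.mem_ofPred_eq, not_or, not_le] at hcon hy
  obtain ⟨c1, c2⟩ := hcon
  have c2' := abs_lt_of_sq_lt_sq c2 (by positivity)
  have c1' : |∑ e, (pairProb (p n) (x n e y) - p n ^ 2 * x n e y ^ 2)| < ε / 3 := by
    refine lt_of_le_of_lt ((Finset.abs_sum_le_sum_abs _ _).trans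
      ((Finset.sum_le_sum fun e _ => abs_pairProb_sub_le h1.le h2 (h.nonneg n e y)).trans
        (le_abs_self _))) c1
  have e1 : ∑ e, pairProb (p n) (x n e y) - l * M 2 =
      ∑ e, (pairProb (p n) (x n e y) - p n ^ 2 * x n e y ^ 2) +
      p n ^ 2 * ∑ e, (x n e y ^ 2 - M 2) + ((Nat.card (E n) : ℝ) * p n ^ 2 * M 2 - l * M 2) := by
    rw [Finset.sum_sub_distrib, Finset.sum_sub_distrib, ← Finset.mul_sum, Finset.sum_const,
      nsmul_eq_mul, Finset.card_univ, Nat.card_eq_fintype_card]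
    ring
  rw [e1] at hy
  have := (abs_add_le _ _).trans (add_le_add_left (abs_add_le
    (∑ e, (pairProb (p n) (x n e y) - p n ^ 2 * x n e y ^ 2))
    (p n ^ 2 * ∑ e, (x n e y ^ 2 - M 2))) |(Nat.card (E n) : ℝ) * p n ^ 2 * M 2 - l * M 2|)
  linarith

/-- Poisson limit under the product Gibbs measure. -/
lemma tendsto_sum_prod_pairProb (h : NormalizedFactors P x M p l) (g : ℕ → ℝ) (C K : ℝ)
    (hK : 0 ≤ K) (hg : ∀ k, |g k| ≤ C * K ^ k) {ε : ℝ} (hε : 0 < ε) :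
    Tendsto (fun n => P.real {y | ε ≤ |∑ Λ : Finset (E n), g Λ.card *
      ∏ e ∈ Λ, pairProb (p n) (x n e y) - ∑' k, g k * ((l * M 2) ^ k / k.factorial)|})
      atTop (𝓝 0) := by
  have hl : 0 ≤ l * M 2 := mul_nonneg h.limit_nonneg (zero_le_one.trans h.one_le_moment_two)
  -- The error bound of `abs_sum_prod_sub_tsum_le` is continuous in `(∑ q, ∑ q²)` and vanishes at
  -- `(l * M 2, 0)`.
  have hcont : Continuous fun z : ℝ × ℝ => C * (Real.exp (K * z.1) * (2 * K ^ 2 * z.2) +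
      |Real.exp (K * z.1) - Real.exp (K * (l * M 2))|) := by fun_prop
  have h0 := hcont.tendsto (l * M 2, 0)
  simp only [mul_zero, sub_self, abs_zero, add_zero] at h0
  obtain ⟨δ, hδ, hball⟩ := Metric.mem_nhds_iff.1 (h0.eventually_lt_const hε)
  refine tendsto_measureReal_mono (Eventually.of_forall fun n y hy => ?_)
    (tendsto_measureReal_union (h.tendsto_sum_pairProb hδ) (h.tendsto_sum_pairProb_sq hδ))
  by_contra hcon
  simp only [Set.mem_union, Set.mem_ofPred_eq, not_or, not_le] at hcon hy
  have hm : ((∑ e, pairProb (p n) (x n e y), ∑ e, pairProb (p n) (x n e y) ^ 2) : ℝ × ℝ) ∈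
      Metric.ball (l * M 2, (0 : ℝ)) δ := by
    have hw : 0 ≤ ∑ e, pairProb (p n) (x n e y) ^ 2 := Finset.sum_nonneg fun e _ => sq_nonneg _
    rw [Metric.mem_ball, Prod.dist_eq, max_lt_iff, Real.dist_eq, Real.dist_0_eq_abs,
      abs_of_nonneg hw]
    exact hcon
  have h2 := abs_sum_prod_sub_tsum_le g C K hK hg (fun e => pairProb (p n) (x n e y))
    (fun e => pairProb_nonneg _ _) _ hl
  have h3 : C * (Real.exp (K * ∑ e, pairProb (p n) (x n e y)) *
      (2 * K ^ 2 * ∑ e, pairProb (p n) (x n e y) ^ 2) +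
      |Real.exp (K * ∑ e, pairProb (p n) (x n e y)) - Real.exp (K * (l * M 2))|) < ε := hball hm
  linarith

lemma sum_chaos_sq (h : NormalizedFactors P x M p l) (n : ℕ) (u : Finset (E n) → ℝ) (K : ℝ) :
    Integrable (fun y => ∑ Λ : Finset (E n), K ^ Λ.card * chaos u (fun e => x n e y) Λ ^ 2) P ∧
    ∫ y, ∑ Λ : Finset (E n), K ^ Λ.card * chaos u (fun e => x n e y) Λ ^ 2 ∂P =
      ∑ Δ : Finset (E n), u Δ ^ 2 * (K * M 2 + (M 2 - 1)) ^ Δ.card := by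
  have h2 := h.integrable 2 two_ne_zero n
  exact ⟨integrable_finsetSum _ fun Λ _ =>
      (integrable_chaos_sq (h.measurable n) (h.indep n) h2 u Λ).const_mul _,
    sum_integral_chaos_sq (h.measurable n) (h.indep n) h2 (h.integral_eq_one n)
      (h.moment 2 two_ne_zero n) u K⟩

/-- The weighted second moments of the product measure are tight. -/
lemma exists_measureReal_sum_chaos_sq_le (h : NormalizedFactors P x M p l) (K : ℝ) (hK : 0 ≤ K)
    {α : ℝ} (hα : 0 < α) :
    ∃ R > 0, ∀ᶠ n in atTop, P.real {y | R ≤ ∑ Λ : Finset (E n), K ^ Λ.card *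
      chaos (fun Δ => p n ^ Δ.card) (fun e => x n e y) Λ ^ 2} ≤ α := by
  have hL : 0 ≤ K * M 2 + (M 2 - 1) := by
    have := h.one_le_moment_two
    have := mul_nonneg hK (zero_le_one.trans this); linarith
  set L := K * M 2 + (M 2 - 1)
  have hev : ∀ᶠ n in atTop, (Nat.card (E n) : ℝ) * p n ^ 2 ≤ l + 1 :=
    h.card_tendsto.eventually_le_const (by linarith)
  refine ⟨Real.exp ((l + 1) * L) / α, by positivity, ?_⟩
  filter_upwards [hev, h.prob_pos] with n hn hp
  obtain ⟨i1, i2⟩ := h.sum_chaos_sq n (fun Δ => p n ^ Δ.card) K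
  refine (measureReal_le_div (fun y => Finset.sum_nonneg fun Λ _ => by positivity) i1
    (b := Real.exp ((l + 1) * L)) ?_ (by positivity)).trans (le_of_eq ?_)
  · rw [i2]
    have e : ∀ Δ : Finset (E n), (p n ^ Δ.card) ^ 2 * L ^ Δ.card = (p n ^ 2 * L) ^ Δ.card := by
      intro Δ; rw [mul_pow, ← pow_mul, ← pow_mul, mul_comm 2]
    refine (Finset.sum_congr rfl fun Δ _ => e Δ).trans_le ?_
    have h1 := Fintype.sum_pow_mul_eq_add_pow (E n) (p n ^ 2 * L) 1
    simp only [one_pow, mul_one] at h1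
    rw [h1, ← Nat.card_eq_fintype_card]
    calc (p n ^ 2 * L + 1) ^ Nat.card (E n) ≤ Real.exp (p n ^ 2 * L) ^ Nat.card (E n) := by
          gcongr; exact Real.add_one_le_exp _
      _ = Real.exp (Nat.card (E n) * p n ^ 2 * L) := by rw [← Real.exp_nat_mul, mul_assoc]
      _ ≤ _ := by gcongr
  · field_simp

/-- The normalized partition function of the product measure is bounded away from zero in
probability. -/
lemma exists_measureReal_chaos_empty_lt_le (h : NormalizedFactors P x M p l)
    {α : ℝ} (hα : 0 < α) :
    ∃ κ > 0, ∀ᶠ n in atTop, P.real {y | chaos (fun Δ => p n ^ Δ.card) (fun e => x n e y) ∅ < κ} ≤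
      α := by
  have hev : ∀ᶠ n in atTop, (Nat.card (E n) : ℝ) * p n ^ 2 ≤ l + 1 :=
    h.card_tendsto.eventually_le_const (by linarith)
  have hl := h.limit_nonneg
  have hM := h.one_le_moment_two
  -- The numerator bounds the mean of the exponent: `|E| p² (M 2 - 1)` arises once from the variance
  -- of the sum and twice from the sum of squares.
  set R := (1 + 3 * (l + 1) * (M 2 - 1)) / α with hR
  have hM' : 0 ≤ M 2 - 1 := by linarith
  have hRpos : 0 < R := by positivity
  refine ⟨Real.exp (-R), Real.exp_pos _, ?_⟩
  filter_upwards [hev, h.prob_pos, h.eventually_le_half] with n hn hp hp2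
  have h2 := h.integrable 2 two_ne_zero n
  obtain ⟨i1, i2⟩ := sum_sub_sq_integral (P := P) (h.measurable n) (h.indep n) h2
    (h.integral_eq_one n) (h.moment 2 two_ne_zero n)
  have i3 : ∀ e, Integrable (fun y => (x n e y - 1) ^ 2) P ∧
      ∫ y, (x n e y - 1) ^ 2 ∂P = M 2 - 1 := by
    intro e
    have hLp : MemLp (x n e) 2 P :=
      (memLp_two_iff_integrable_sq (h.measurable n e).aestronglyMeasurable).2 (h2 e)
    refine ⟨(hLp.sub (memLp_const 1)).integrable_sq, ?_⟩
    have := integral_sub_one_sq (h.measurable n) h2 (h.integral_eq_one n)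
      (h.moment 2 two_ne_zero n) e
    simpa only [← sq] using this
  have j1 : Integrable (fun y => 1 + (p n * ∑ e, (x n e y - 1)) ^ 2) P := by
    simp only [mul_pow]
    exact (integrable_const _).add (i1.const_mul _)
  have j2 : Integrable (fun y => 2 * p n ^ 2 * ∑ e, (x n e y - 1) ^ 2) P :=
    (integrable_finsetSum _ fun e _ => (i3 e).1).const_mul _
  refine le_trans (measureReal_mono (s₂ := {y | R ≤ 1 + (p n * ∑ e, (x n e y - 1)) ^ 2 +
    2 * p n ^ 2 * ∑ e, (x n e y - 1) ^ 2}) fun y hy => ?_)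
    ((measureReal_le_div (f := fun y => 1 + (p n * ∑ e, (x n e y - 1)) ^ 2 +
      2 * p n ^ 2 * ∑ e, (x n e y - 1) ^ 2) (b := 1 + 3 * (l + 1) * (M 2 - 1))
      (fun y => ?_) (j1.add j2) ?_ hRpos).trans (le_of_eq ?_))
  · by_contra hcon
    simp only [Set.mem_ofPred_eq, not_le] at hy hcon
    have := (exp_le_chaos_pow_card_empty hp.le hp2 (fun e => x n e y)
      fun e => h.nonneg n e y).trans_lt hy
    rw [Real.exp_lt_exp] at this
    linarith
  · have : 0 ≤ ∑ e, (x n e y - 1) ^ 2 := Finset.sum_nonneg fun e _ => sq_nonneg _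
    positivity
  · rw [integral_add j1 j2]
    simp only [mul_pow]
    rw [integral_add (integrable_const _) (i1.const_mul _), integral_const_mul, integral_const_mul,
      i2, integral_finsetSum _ fun e _ => (i3 e).1]
    simp only [i3]
    rw [Finset.sum_const, nsmul_eq_mul, Finset.card_univ, ← Nat.card_eq_fintype_card]
    simp only [integral_const, probReal_univ, smul_eq_mul, mul_one, one_pow]
    nlinarith [mul_le_mul_of_nonneg_right hn hM']
  · rw [hR]
    have : (1 + 3 * (l + 1) * (M 2 - 1)) ≠ 0 := by positivity
    field_simp

/-- Convergence in probability of the ratio of chaos sums, for coefficients `u n` that are close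
to those of independent edges. -/
theorem tendstoInMeasure_div (h : NormalizedFactors P x M p l)
    (u : ∀ n, Finset (E n) → ℝ)
    (hu : ∀ L : ℝ, 0 ≤ L → Tendsto (fun n => ∑ Δ : Finset (E n),
      (u n Δ - p n ^ Δ.card) ^ 2 * L ^ Δ.card) atTop (𝓝 0))
    (g : ℕ → ℝ) (C K : ℝ) (hK : 0 ≤ K) (hg : ∀ k, |g k| ≤ C * K ^ k) :
    TendstoInMeasure P
      (fun n y => (∑ Λ : Finset (E n), g Λ.card * chaos (u n) (fun e => x n e y) Λ ^ 2) /
        chaos (u n) (fun e => x n e y) ∅ ^ 2) atTop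
      (fun _ => ∑' k, g k * ((l * M 2) ^ k / k.factorial)) := by
  rw [tendstoInMeasure_iff_measureReal_dist]
  intro ε hε
  set F := ∑' k, g k * ((l * M 2) ^ k / k.factorial)
  have hC : 0 ≤ C := by have := (abs_nonneg _).trans (hg 0); simpa using this
  have hL : 0 ≤ K * M 2 + (M 2 - 1) := by
    have := h.one_le_moment_two
    have := mul_nonneg hK (zero_le_one.trans this); linarith
  refine tendsto_order.2 ⟨fun a ha => Eventually.of_forall fun n =>
    ha.trans_le measureReal_nonneg, fun a ha => ?_⟩
  -- Four bad events, each eventually of probability at most `a / 5`. Since `R` and `κ` do not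
  -- depend on `n`, `η` is fixed from them, then `τ` from `η`; off the bad events the numerator of
  -- the error is at most `3/4` of `ε * κ ^ 2`.
  obtain ⟨R, hR, hRev⟩ := h.exists_measureReal_sum_chaos_sq_le K hK (α := a / 5) (by positivity)
  obtain ⟨κ', hκ', hκev⟩ := h.exists_measureReal_chaos_empty_lt_le (α := a / 5) (by positivity)
  obtain ⟨κ, hκ, rfl⟩ : ∃ κ > 0, κ' = 2 * κ := ⟨κ' / 2, by positivity, by ring⟩
  set D := C + |F| + 1 with hD
  have hDpos : 0 < D := by positivity
  set η := ε * κ ^ 2 / (4 * D * R) with hη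
  have hηpos : 0 < η := by positivity
  set τ := min (κ ^ 2) (ε * κ ^ 2 / (4 * D * (1 + 1 / η))) with hτ
  have hτpos : 0 < τ := by positivity
  set σ := ε * κ ^ 2 / (4 * R) with hσ
  have hσpos : 0 < σ := by positivity
  have hU := tendsto_measureReal_of_integral_le (P := P)
    (X := fun n y => ∑ Λ : Finset (E n), K ^ Λ.card *
      chaos (fun Δ => u n Δ - p n ^ Δ.card) (fun e => x n e y) Λ ^ 2)
    (Eventually.of_forall fun n => ⟨fun y => Finset.sum_nonneg fun Λ _ => by positivity,
      (h.sum_chaos_sq n _ K).1, (h.sum_chaos_sq n _ K).2.le⟩) (hu _ hL) hτpos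
  have hQ := h.tendsto_sum_prod_pairProb g C K hK hg hσpos
  filter_upwards [hRev, hκev, hU.eventually_lt_const (by positivity : 0 < a / 5),
    hQ.eventually_lt_const (by positivity : 0 < a / 5), h.prob_pos, h.eventually_le_half]
    with n h1 h2 h3 h4 hp hp2
  refine lt_of_le_of_lt ?_ (by linarith : a / 5 + a / 5 + a / 5 + a / 5 < a)
  refine le_trans (measureReal_mono ?_) ((measureReal_union_le _ _).trans
    (add_le_add ((measureReal_union_le _ _).trans (add_le_add ((measureReal_union_le _ _).trans
      (add_le_add h1 h2)) h3.le)) h4.le))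
  intro y hy
  by_contra hcon
  simp only [Set.mem_union, Set.mem_ofPred_eq, not_or, not_le, not_lt] at hcon hy
  obtain ⟨⟨⟨c1, c2⟩, c3⟩, c4⟩ := hcon
  have key := abs_div_chaos_sq_sub_le g C K hK hg (u n) (fun Δ => p n ^ Δ.card)
    (fun e => x n e y) F _ η κ hηpos hκ
    (sum_mul_chaos_pow_card_sq hp.le hp2 (fun e => x n e y) (fun e => h.nonneg n e y) g) c2
    (c3.le.trans (min_le_left _ _))
  rw [Real.dist_eq] at hy
  set U := ∑ Λ : Finset (E n), K ^ Λ.card *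
    chaos (fun Δ => u n Δ - p n ^ Δ.card) (fun e => x n e y) Λ ^ 2
  set T := ∑ Λ : Finset (E n), K ^ Λ.card *
    chaos (fun Δ => p n ^ Δ.card) (fun e => x n e y) Λ ^ 2
  set Q := ∑ Λ : Finset (E n), g Λ.card * ∏ e ∈ Λ, pairProb (p n) (x n e y)
  have hle := hy.trans key
  rw [le_div_iff₀ (by positivity)] at hle
  have b1 : (1 + 1 / η) * U ≤ ε * κ ^ 2 / (4 * D) := by
    have := c3.le.trans (min_le_right _ _)
    rw [le_div_iff₀ (by positivity)] at this
    rw [le_div_iff₀ (by positivity)]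
    linarith
  have b2 : η * T ≤ ε * κ ^ 2 / (4 * D) := by
    refine (mul_le_mul_of_nonneg_left c1.le hηpos.le).trans (le_of_eq ?_)
    rw [hη]; field_simp
  have b3 : T * |Q - F| ≤ ε * κ ^ 2 / 4 := by
    refine (mul_le_mul c1.le c4.le (abs_nonneg _) hR.le).trans (le_of_eq ?_)
    rw [hσ]; field_simp
  have b4 : (C + |F|) * ((1 + 1 / η) * U + η * T) ≤ D * (ε * κ ^ 2 / (4 * D) + ε * κ ^ 2 / (4 * D)) :=
    (mul_le_mul_of_nonneg_left (add_le_add b1 b2) (by positivity)).trans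
      (mul_le_mul_of_nonneg_right (by linarith) (by positivity))
  have b5 : D * (ε * κ ^ 2 / (4 * D) + ε * κ ^ 2 / (4 * D)) = ε * κ ^ 2 / 2 := by
    field_simp; ring
  have : 0 < ε * κ ^ 2 := by positivity
  linarith

end NormalizedFactors
end Limit

/-! ### Finite differences and Poisson expectations -/

section Differences

lemma abs_fwdDiff_iter_le (f : ℕ → ℝ) (C : ℝ) (hf : ∀ k, |f k| ≤ C) (k : ℕ) (y : ℕ) :
    |(fwdDiff 1)^[k] f y| ≤ C * 2 ^ k := by
  induction k generalizing y with
  | zero => simpa using hf y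
  | succ k ih =>
    rw [Function.iterate_succ_apply', fwdDiff]
    refine (abs_sub _ _).trans ((add_le_add (ih _) (ih _)).trans (le_of_eq ?_))
    rw [pow_succ]; ring

lemma fwdDiff_iter_exp (θ : ℝ) (k : ℕ) (y : ℕ) :
    (fwdDiff 1)^[k] (fun j : ℕ => Real.exp (θ * j)) y =
      (Real.exp θ - 1) ^ k * Real.exp (θ * y) := by
  induction k generalizing y with
  | zero => simp
  | succ k ih =>
    rw [Function.iterate_succ_apply', fwdDiff, ih, ih, pow_succ]
    push_cast
    rw [mul_add, Real.exp_add, mul_one]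
    ring

/-- The expectation under the Poisson distribution as a series of factorial moments. -/
lemma integral_poissonMeasure_eq_tsum (f : ℕ → ℝ) (C : ℝ) (hf : ∀ k, |f k| ≤ C) (r : ℝ)
    (hr : 0 ≤ r) :
    ∫ k, f k ∂(poissonMeasure r.toNNReal) =
      ∑' k, (fwdDiff 1)^[k] f 0 * (r ^ k / k.factorial) := by
  have hg := fun k => abs_fwdDiff_iter_le f C hf k 0
  have s1 := (summable_mul_pow_div_factorial (fun k => (fwdDiff 1)^[k] f 0) C 2 hg r).norm
  have s2 := (hasSum_exp_pow r).summable.norm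
  -- The Cauchy product of the factorial-moment series with that of `exp r` has `n`-th term `f n * r
  -- ^ n / n!`, by Newton's formula.
  have h := tsum_mul_tsum_eq_tsum_sum_range_of_summable_norm s1 s2
  rw [(hasSum_exp_pow r).tsum_eq] at h
  have h2 : ∀ n, ∑ k ∈ Finset.range (n + 1), (fwdDiff 1)^[k] f 0 * (r ^ k / k.factorial) *
      (r ^ (n - k) / (n - k).factorial) = r ^ n / n.factorial * f n := by
    intro n
    have h3 := shift_eq_sum_fwdDiff_iter 1 f n 0
    simp only [smul_eq_mul, mul_one, zero_add, nsmul_eq_mul] at h3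
    rw [h3, Finset.mul_sum]
    refine Finset.sum_congr rfl fun k hk => ?_
    have hkn : k ≤ n := Nat.lt_succ_iff.1 (Finset.mem_range.1 hk)
    rw [Nat.cast_choose ℝ hkn]
    have e : r ^ n = r ^ k * r ^ (n - k) := by rw [← pow_add, Nat.add_sub_cancel' hkn]
    rw [e]
    field_simp
  simp only [h2] at h
  rw [integral_poissonMeasure, Real.coe_toNNReal r hr]
  simp only [smul_eq_mul, mul_div_assoc, mul_assoc]
  rw [tsum_mul_left, ← h, mul_comm (tsum _), ← mul_assoc, ← Real.exp_add]
  simp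

end Differences

/-! ### Asymptotics of the graph parameters -/

section Asymptotic

variable {V : ℕ → Type*} [∀ n, Fintype (V n)] {G : ∀ n, SimpleGraph (V n)} {c : ℕ}
  {S : ∀ n, Finset (Finset (G n).edgeSet)} {m : ℕ → ℕ} {γ : ℝ}

lemma tendsto_card_vertices (hG : GraphAssumption G c) (hS : OptimizationAssumption G S m γ) :
    Tendsto (fun n => (Fintype.card (V n) : ℝ)) atTop atTop := by
  -- If `c = 0` there are eventually no edges, and the ratio defining `γ` is 0 by division by zero,
  -- against `0 < γ`.
  have hc : c ≠ 0 := by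
    rintro rfl
    obtain ⟨k, hk⟩ := hG.card_edges.1.bound
    have h0 : Tendsto (fun n => (m n : ℝ) ^ 2 / (2 * (Nat.card (G n).edgeSet : ℝ))) atTop (𝓝 0) := by
      refine tendsto_const_nhds.congr' ?_
      filter_upwards [hk, hG.card_vertices] with n h1 h2
      rw [h2] at h1
      have : (Nat.card (G n).edgeSet : ℝ) = 0 := by simpa using h1
      rw [this]; simp
    exact hS.gamma_pos.ne (tendsto_nhds_unique h0 hS.tendsto_gamma)
  have h1 : Tendsto (fun n : ℕ => (c : ℝ) * n) atTop atTop :=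
    tendsto_natCast_atTop_atTop.const_mul_atTop (by positivity)
  refine h1.congr' ?_
  filter_upwards [hG.card_vertices] with n hn
  rw [hn]; push_cast; rfl

/-- The number of edges is at least of the order of the squared number of vertices. -/
lemma exists_sq_card_vertices_le (hG : GraphAssumption G c) :
    ∃ k > 0, ∀ᶠ n in atTop, (Fintype.card (V n) : ℝ) ^ 2 ≤ k * Nat.card (G n).edgeSet := by
  obtain ⟨k, hk0, hk⟩ := hG.card_edges.2.exists_pos
  refine ⟨k, hk0, ?_⟩
  filter_upwards [hk.bound] with n hn
  simpa using hn

lemma tendsto_card_edges (hG : GraphAssumption G c) (hS : OptimizationAssumption G S m γ) :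
    Tendsto (fun n => (Nat.card (G n).edgeSet : ℝ)) atTop atTop := by
  obtain ⟨k, hk0, hk⟩ := exists_sq_card_vertices_le hG
  have h1 : Tendsto (fun n => (Fintype.card (V n) : ℝ) ^ 2 / k) atTop atTop :=
    ((tendsto_pow_atTop two_ne_zero).comp (tendsto_card_vertices hG hS)).atTop_div_const hk0
  refine tendsto_atTop_mono' _ ?_ h1
  filter_upwards [hk] with n hn
  rw [div_le_iff₀ hk0, mul_comm]
  exact hn

lemma tendsto_card_mul_sq (hG : GraphAssumption G c) (hS : OptimizationAssumption G S m γ) :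
    Tendsto (fun n => (Nat.card (G n).edgeSet : ℝ) * ((m n : ℝ) / Nat.card (G n).edgeSet) ^ 2)
      atTop (𝓝 (2 * γ)) := by
  refine (hS.tendsto_gamma.const_mul 2).congr' ?_
  filter_upwards [(tendsto_card_edges hG hS).eventually_gt_atTop 0] with n hn
  field_simp

lemma tendsto_zero_of_sq {a : ℕ → ℝ} (ha : ∀ n, 0 ≤ a n)
    (h : Tendsto (fun n => a n ^ 2) atTop (𝓝 0)) : Tendsto a atTop (𝓝 0) := by
  have := (Real.continuous_sqrt.tendsto 0).comp h
  rw [Real.sqrt_zero] at this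
  refine this.congr fun n => ?_
  exact Real.sqrt_sq (ha n)

lemma tendsto_edgeProb (hG : GraphAssumption G c) (hS : OptimizationAssumption G S m γ) :
    Tendsto (fun n => (m n : ℝ) / Nat.card (G n).edgeSet) atTop (𝓝 0) := by
  refine tendsto_zero_of_sq (fun n => by positivity) ?_
  have h := (tendsto_card_mul_sq hG hS).mul
    (tendsto_inv_atTop_zero.comp (tendsto_card_edges hG hS))
  rw [mul_zero] at h
  refine h.congr' ?_
  filter_upwards [(tendsto_card_edges hG hS).eventually_gt_atTop 0] with n hn
  simp only [Function.comp]
  field_simp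

lemma eventually_m_pos (hS : OptimizationAssumption G S m γ) : ∀ᶠ n in atTop, 0 < m n := by
  filter_upwards [hS.tendsto_gamma.eventually_const_lt hS.gamma_pos] with n hn
  rw [Nat.pos_iff_ne_zero]
  intro h
  rw [h] at hn
  simp at hn

lemma tendsto_one_div_m (hG : GraphAssumption G c) (hS : OptimizationAssumption G S m γ) :
    Tendsto (fun n => 1 / (m n : ℝ)) atTop (𝓝 0) := by
  refine tendsto_zero_of_sq (fun n => by positivity) ?_
  have h := ((tendsto_card_mul_sq hG hS).inv₀ (by have := hS.gamma_pos; positivity)).mul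
    (tendsto_inv_atTop_zero.comp (tendsto_card_edges hG hS))
  rw [mul_zero] at h
  refine h.congr' ?_
  filter_upwards [(tendsto_card_edges hG hS).eventually_gt_atTop 0, eventually_m_pos hS]
    with n hn hm
  have hm' : (0 : ℝ) < m n := by exact_mod_cast hm
  simp only [Function.comp]
  field_simp

/-- This removes the sets that are not partial matchings: with `|V|² ≤ k |E|` the quantity is at
most `k² (|E| p²)² / |V|`. -/
lemma tendsto_card_cube_mul (hG : GraphAssumption G c) (hS : OptimizationAssumption G S m γ) :
    Tendsto (fun n => (Fintype.card (V n) : ℝ) ^ 3 * ((m n : ℝ) / Nat.card (G n).edgeSet) ^ 4)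
      atTop (𝓝 0) := by
  obtain ⟨k, hk0, hk⟩ := exists_sq_card_vertices_le hG
  have h := (((tendsto_card_mul_sq hG hS).pow 2).const_mul (k ^ 2)).mul
    (tendsto_inv_atTop_zero.comp (tendsto_card_vertices hG hS))
  rw [mul_zero] at h
  refine tendsto_of_tendsto_of_tendsto_of_le_of_le' tendsto_const_nhds h
    (Eventually.of_forall fun n => by positivity) ?_
  filter_upwards [hk, (tendsto_card_vertices hG hS).eventually_gt_atTop 0] with n hn hv
  simp only [Function.comp]
  set v := (Fintype.card (V n) : ℝ)
  set N := (Nat.card (G n).edgeSet : ℝ)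
  set q := (m n : ℝ) / N
  have h4 : v ^ 4 ≤ (k * N) ^ 2 := by
    calc v ^ 4 = (v ^ 2) ^ 2 := by ring
      _ ≤ _ := pow_le_pow_left₀ (sq_nonneg v) hn 2
  rw [← div_eq_mul_inv, le_div_iff₀ hv]
  calc v ^ 3 * q ^ 4 * v = v ^ 4 * q ^ 4 := by ring
    _ ≤ (k * N) ^ 2 * q ^ 4 := by gcongr
    _ = _ := by ring

lemma eventually_edgeProb_eq (hS : OptimizationAssumption G S m γ)
    (hp : ∀ᶠ n in atTop, ∀ e f : (G n).edgeSet, edgeProb (S n) e = edgeProb (S n) f) :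
    ∀ᶠ n in atTop, ∀ e, edgeProb (S n) e = (m n : ℝ) / Nat.card (G n).edgeSet := by
  classical
  filter_upwards [hS.card_eq, hS.extend_matching, hp] with n h1 h2 h3 e
  -- The empty set is a partial matching, so the family is nonempty.
  obtain ⟨π, hπ, -⟩ := h2 ∅ (by simp [IsPartialMatching])
  have : Fintype (G n).edgeSet := Fintype.ofFinite _
  exact edgeProb_eq (S n) ⟨π, hπ⟩ (m n) h1 h3 e

lemma tendsto_sum_unifProb_sub_pow_sq [∀ n, Fintype (G n).edgeSet] (hG : GraphAssumption G c)
    (hS : OptimizationAssumption G S m γ)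
    (hp : ∀ᶠ n in atTop, ∀ e f : (G n).edgeSet, edgeProb (S n) e = edgeProb (S n) f)
    (L : ℝ) (hL : 0 ≤ L) :
    Tendsto (fun n => ∑ Δ : Finset (G n).edgeSet,
      (unifProb (S n) Δ - ((m n : ℝ) / Nat.card (G n).edgeSet) ^ Δ.card) ^ 2 * L ^ Δ.card)
      atTop (𝓝 0) := by
  obtain ⟨ρ₁, hρ₁, hmat⟩ := hS.matching_bound
  obtain ⟨ρ₂, hρ₂, hnon⟩ := hS.nonmatching_bound
  have hlim := tendsto_card_mul_sq hG hS
  have hexp : ∀ a : ℝ, Tendsto (fun n => Real.exp ((Nat.card (G n).edgeSet : ℝ) *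
      ((a * ((m n : ℝ) / Nat.card (G n).edgeSet)) ^ 2 * L))) atTop
      (𝓝 (Real.exp (2 * γ * (a ^ 2 * L)))) := by
    intro a
    refine (Real.continuous_exp.tendsto _).comp ((hlim.mul_const (a ^ 2 * L)).congr fun n => ?_)
    ring
  have t1 := (tendsto_one_div_m hG hS).mul (hexp ρ₁)
  have t2 := ((tendsto_card_cube_mul hG hS).mul_const (((1 + ρ₂) ^ 2 * L) ^ 2)).mul (hexp (1 + ρ₂))
  have t := t1.add t2
  simp only [zero_mul, add_zero] at t
  refine tendsto_of_tendsto_of_tendsto_of_le_of_le' tendsto_const_nhds t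
    (Eventually.of_forall fun n => Finset.sum_nonneg fun Δ _ => by positivity) ?_
  filter_upwards [hmat, hnon, eventually_edgeProb_eq hS hp, eventually_m_pos hS,
    (tendsto_card_edges hG hS).eventually_gt_atTop 0] with n h1 h2 h3 h4 h5
  have hm' : (0 : ℝ) < m n := by exact_mod_cast h4
  have key := sum_unifProb_sub_pow_sq_le (G n) (S n) (m n) ((m n : ℝ) / Nat.card (G n).edgeSet)
    ρ₁ ρ₂ L (by positivity) hρ₂.le hL h3 h1 h2
  refine le_trans (le_of_eq ?_) (key.trans (le_of_eq ?_))
  · congr!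
  · ring

end Asymptotic

/-! ### Application to the Gibbs measure -/

section Main

variable {V : ℕ → Type*} [∀ n, Fintype (V n)] {G : ∀ n, SimpleGraph (V n)} {c : ℕ}
  {S : ∀ n, Finset (Finset (G n).edgeSet)} {m : ℕ → ℕ} {γ : ℝ}
  {Ω : Type*} [MeasurableSpace Ω] {P : Measure Ω} [IsProbabilityMeasure P]
  {ω : ∀ n, (G n).edgeSet → Ω → EReal} {ν : Measure EReal} [IsProbabilityMeasure ν]

omit [∀ n, Fintype (V n)] [IsProbabilityMeasure P] in
lemma laplace_toReal_pos (hω : WeightAssumption G P ω ν) {β : ℝ} (hβ : 0 < β) :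
    0 < (laplace ν β).toReal :=
  ENNReal.toReal_pos (laplace_pos hβ hω.not_ae_top).ne' (hω.laplace_lt_top β hβ).ne

omit [∀ n, Fintype (V n)] [IsProbabilityMeasure P] in
-- The variance of the edge factor is nonnegative.
lemma sq_laplace_le (hω : WeightAssumption G P ω ν) {β : ℝ} (hβ : 0 < β) :
    (laplace ν β).toReal ^ 2 ≤ (laplace ν (2 * β)).toReal := by
  obtain ⟨i1, e1⟩ := integrable_edgeFactor_pow (P := ν) measurable_id Measure.map_id hβ
    hω.laplace_lt_top one_ne_zero
  obtain ⟨i2, e2⟩ := integrable_edgeFactor_pow (P := ν) measurable_id Measure.map_id hβ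
    hω.laplace_lt_top two_ne_zero
  have hm : MemLp (edgeFactor β) 2 ν :=
    (memLp_two_iff_integrable_sq (measurable_edgeFactor β).aestronglyMeasurable).2 i2
  have hv := variance_eq_sub hm
  have hv0 := variance_nonneg (edgeFactor β) ν
  simp only [id, pow_one, Nat.cast_one, one_mul, Nat.cast_ofNat] at e1 e2
  have e2' : ∫ y, (edgeFactor β ^ 2) y ∂ν = (laplace ν (2 * β)).toReal := e2
  rw [hv, e1, e2'] at hv0
  linarith

omit [IsProbabilityMeasure P] in
lemma normalizedFactors [∀ n, Fintype (G n).edgeSet] (hG : GraphAssumption G c)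
    (hω : WeightAssumption G P ω ν) (hS : OptimizationAssumption G S m γ) {β : ℝ} (hβ : 0 < β) :
    NormalizedFactors P (fun n e y => edgeFactor β (ω n e y) / (laplace ν β).toReal)
      (fun k => (laplace ν (k * β)).toReal / (laplace ν β).toReal ^ k)
      (fun n => (m n : ℝ) / Nat.card (G n).edgeSet) (2 * γ) where
  measurable n e := ((measurable_edgeFactor β).comp (hω.measurable n e)).div_const _
  indep n := (hω.indep n).comp (fun _ t => edgeFactor β t / (laplace ν β).toReal)
    fun _ => (measurable_edgeFactor β).div_const _
  nonneg n e y := div_nonneg ENNReal.toReal_nonneg ENNReal.toReal_nonneg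
  integrable k hk n e := by
    simp only [div_pow]
    exact (integrable_edgeFactor_pow (hω.measurable n e) (hω.law n e) hβ hω.laplace_lt_top
      hk).1.div_const _
  moment k hk n e := by
    simp only [div_pow]
    rw [integral_div, (integrable_edgeFactor_pow (hω.measurable n e) (hω.law n e) hβ
      hω.laplace_lt_top hk).2]
  moment_one := by
    simp [(laplace_toReal_pos hω hβ).ne']
  one_le_moment_two := by
    rw [le_div_iff₀ (pow_pos (laplace_toReal_pos hω hβ) 2), one_mul]
    simpa using sq_laplace_le hω hβ
  prob_pos := by
    filter_upwards [eventually_m_pos hS, (tendsto_card_edges hG hS).eventually_gt_atTop 0]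
      with n h4 h5
    have hm' : (0 : ℝ) < m n := by exact_mod_cast h4
    positivity
  prob_tendsto := tendsto_edgeProb hG hS
  card_tendsto := tendsto_card_mul_sq hG hS

omit [IsProbabilityMeasure P] [IsProbabilityMeasure ν] in
lemma ae_ne_bot (hω : WeightAssumption G P ω ν) (n : ℕ) : ∀ᵐ y ∂P, ∀ e, ω n e y ≠ ⊥ := by
  rw [ae_all_iff]
  intro e
  have h := ae_ne_bot_of_laplace (ν := ν) one_pos (hω.laplace_lt_top 1 one_pos)
  rw [← hω.law n e] at h
  exact ae_of_ae_map (hω.measurable n e).aemeasurable h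

/-- Convergence of the overlap averages of `f`, for `f` with exponentially bounded differences. -/
theorem tendstoInMeasure_overlapAverage (hG : GraphAssumption G c)
    (hω : WeightAssumption G P ω ν) (hS : OptimizationAssumption G S m γ)
    (hp : ∀ᶠ n in atTop, ∀ e f : (G n).edgeSet, edgeProb (S n) e = edgeProb (S n) f)
    {β : ℝ} (hβ : 0 < β) (f : ℕ → ℝ) (C K : ℝ) (hK : 0 ≤ K)
    (hf : ∀ k, |(fwdDiff 1)^[k] f 0| ≤ C * K ^ k) :
    TendstoInMeasure P (fun n y => overlapAverage (S n) β (fun e => ω n e y) f) atTop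
      (fun _ => ∑' k, (fwdDiff 1)^[k] f 0 *
        ((2 * γ * Real.exp (psi ν (2 * β) - 2 * psi ν β)) ^ k / k.factorial)) := by
  classical
  have (n : ℕ) : Fintype (G n).edgeSet := Fintype.ofFinite _
  have h := (normalizedFactors hG hω hS hβ).tendstoInMeasure_div (fun n => unifProb (S n))
    (tendsto_sum_unifProb_sub_pow_sq hG hS hp) (fun k => (fwdDiff 1)^[k] f 0) C K hK hf
  have hr : 2 * γ * Real.exp (psi ν (2 * β) - 2 * psi ν β) =
      2 * γ * ((laplace ν ((2 : ℕ) * β)).toReal / (laplace ν β).toReal ^ 2) := by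
    have h1 := laplace_toReal_pos hω hβ
    have h2 := laplace_toReal_pos hω (by positivity : 0 < 2 * β)
    rw [psi, psi, Real.exp_sub, Real.exp_log h2, two_mul (Real.log _), Real.exp_add,
      Real.exp_log h1, ← sq]
    norm_num
  rw [hr]
  refine h.congr' ?_ (ae_of_all _ fun _ => rfl)
  filter_upwards [hS.card_eq] with n hn
  filter_upwards [ae_ne_bot hω n] with y hy
  exact (overlapAverage_eq (S n) (m n) hn hβ (fun e => ω n e y) hy (laplace_toReal_pos hω hβ)
    f).symm

end Main

end GibbsOverlap

theorem theorem2p4 {V : ℕ → Type*} [∀ n, Fintype (V n)] (G : ∀ n, SimpleGraph (V n)) (c : ℕ)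
    (hG : GibbsOverlap.GraphAssumption G c)
    {Ω : Type*} [MeasurableSpace Ω] (P : Measure Ω) [IsProbabilityMeasure P]
    (ω : ∀ n, (G n).edgeSet → Ω → EReal) (ν : Measure EReal) [IsProbabilityMeasure ν]
    (hω : GibbsOverlap.WeightAssumption G P ω ν)
    (S : ∀ n, Finset (Finset (G n).edgeSet)) (m : ℕ → ℕ) (γ : ℝ)
    (hS : GibbsOverlap.OptimizationAssumption G S m γ)
    (hp : ∀ᶠ n in atTop, ∀ e f : (G n).edgeSet,
      GibbsOverlap.edgeProb (S n) e = GibbsOverlap.edgeProb (S n) f)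
    (β : ℝ) (hβ : 0 < β) (r : ℝ)
    (hr : r = 2 * γ *
      Real.exp (GibbsOverlap.psi ν (2 * β) - 2 * GibbsOverlap.psi ν β)) :
    (∀ f : ℕ → ℝ, (∃ C : ℝ, ∀ k, |f k| ≤ C) →
      TendstoInMeasure P
        (fun n x => GibbsOverlap.overlapAverage (S n) β (fun e => ω n e x) f) atTop
        (fun _ => ∫ k, f k ∂(poissonMeasure r.toNNReal))) ∧
    (∀ θ : ℝ,
      TendstoInMeasure P
        (fun n x => GibbsOverlap.overlapAverage (S n) β (fun e => ω n e x)
          fun k => Real.exp (θ * k)) atTop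
        (fun _ => Real.exp (r * (Real.exp θ - 1)))) := by
  have hγ := hS.gamma_pos
  have hr0 : 0 ≤ r := by rw [hr]; positivity
  refine ⟨fun f hf => ?_, fun θ => ?_⟩
  -- A `k`-th difference of a function bounded by `C` is at most `C * 2 ^ k`, hence `K = 2`.
  · obtain ⟨C, hC⟩ := hf
    have h := GibbsOverlap.tendstoInMeasure_overlapAverage hG hω hS hp hβ f C 2 (by norm_num)
      fun k => GibbsOverlap.abs_fwdDiff_iter_le f C hC k 0
    rw [← hr] at h
    rwa [GibbsOverlap.integral_poissonMeasure_eq_tsum f C hC r hr0]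
  -- The exponential may be unbounded, but its differences at 0 are exactly geometric, and the
  -- limiting series sums to `exp (r * (exp θ - 1))`.
  · have e : ∀ k, (fwdDiff 1)^[k] (fun j : ℕ => Real.exp (θ * j)) 0 = (Real.exp θ - 1) ^ k :=
      fun k => by simpa using GibbsOverlap.fwdDiff_iter_exp θ k 0
    have h := GibbsOverlap.tendstoInMeasure_overlapAverage hG hω hS hp hβ
      (fun j : ℕ => Real.exp (θ * j)) 1 |Real.exp θ - 1| (abs_nonneg _)
      fun k => by rw [e, abs_pow, one_mul]
    rw [← hr] at h
    simp only [e, ← mul_div_assoc, ← mul_pow] at h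
    rw [(GibbsOverlap.hasSum_exp_pow _).tsum_eq] at h
    rwa [mul_comm r]
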